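/- For a non-constant complex polynomial $P$ let $\mathcal M(P)$ be the uniform probability measure on its zeros, counted with multiplicity. Write $\log_+ x=\max(0,\log x)$ and $\log_+\frac10=+\infty$. Let $\mu$ be a Borel probability measure on $\mathbb C$, and let $(a_{n,i})_{n\ge1,\,1\le i\le n}$ and $(b_{n,i})_{n\ge1,\,1\le i\le n}$ be two triangular arrays of complex numbers such that - both are $\mu$-distributed: $\frac1n\sum_{i=1}^n\delta_{a_{n,i}}$ and $\frac1n\sum_{i=1}^n\delta_{b_{n,i}}$ converge weakly to $\mu$ as $n\to\infty$; - both are log-Cesàro bounded: the sequences $\frac1n\sum_{i=1}^n\log_+|a_{n,i}|$ and $\frac1n\sum_{i=1}^n\log_+|b_{n,i}|$, $n\ge1$, are bounded; - $\sum_{i=1}^n\log_+\frac1{|a_{n,i}-b_{n,i}|}=o(n^2)$ as $n\to\infty$. Let $(\xi_{n,i})_{n\ge1,\,1\le i\le n}$ be complex random variables on one probability space such that, for each $n$, $\xi_{n,1},\dots,\xi_{n,n}$ are independent and $\xi_{n,i}$ has law $\frac12\delta_{a_{n,i}}+\frac12\delta_{b_{n,i}}$ (no assumption is made on the joint law of different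 rows). Put $P_n(z)=\prod_{i=1}^n(z-\xi_{n,i})$. Then $\mathcal M(P_n)\to\mu$ almost surely, in the topology of weak convergence, and, for every integer $k\ge0$, $\mathcal M(P_n^{(k)})\to\mu$ in probability as $n\to\infty$ (for $n>k$, where $P_n^{(k)}$ is non-constant), i.e. for every neighbourhood $U$ of $\mu$ in the topology of weak convergence, $\mathbf P\big(\mathcal M(P_n^{(k)})\notin U\big)\to0$. -/

import Mathlib

open MeasureTheory ProbabilityTheory Filter Topology
open scoped ENNReal NNReal

noncomputable section

/-- The uniform measure on a finite multiset of complex numbers: the average of the Dirac masses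
at its elements, counted with multiplicity. It is the zero measure for the empty multiset, and a
probability measure otherwise. `FiniteMeasure ℂ` carries the topology of weak convergence
(convergence of integrals of bounded continuous functions). -/
def uniformMeasure (s : Multiset ℂ) : FiniteMeasure ℂ :=
  (s.card : ℝ≥0)⁻¹ • (s.map fun z => (diracProba z).toFiniteMeasure).sum

theorem uniformMeasure_mass (s : Multiset ℂ) (hs : s ≠ 0) : (uniformMeasure s).mass = 1 := by
  have key : ∀ t : Multiset ℂ,
      ((t.map fun z => (diracProba z).toFiniteMeasure).sum).mass = (t.card : ℝ≥0) := by
    intro t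
    induction t using Multiset.induction_on with
    | empty => simp
    | cons z t ih =>
      have hadd : ∀ μ ν : FiniteMeasure ℂ, (μ + ν).mass = μ.mass + ν.mass := by
        intro μ ν
        simp only [FiniteMeasure.mass, FiniteMeasure.coeFn_add, Pi.add_apply]
      rw [Multiset.map_cons, Multiset.sum_cons, hadd, ih]
      simp [add_comm]
  have hc : (s.card : ℝ≥0) ≠ 0 := by simpa using hs
  have hsmul : ∀ (c : ℝ≥0) (μ : FiniteMeasure ℂ), (c • μ).mass = c * μ.mass := by
    intro c μ
    simp only [FiniteMeasure.mass, FiniteMeasure.coeFn_smul, Pi.smul_apply, smul_eq_mul]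
  rw [uniformMeasure, hsmul, key, inv_mul_cancel₀ hc]

/-- `𝓜(p)`: the uniform measure on the zeros of a polynomial, counted with multiplicity. -/
def zeroMeasure (p : Polynomial ℂ) : FiniteMeasure ℂ := uniformMeasure p.roots

/-- A triangular array of complex numbers; row `n` has the `n` entries `a n i`, `i : Fin n`. -/
abbrev TriangularArray : Type := (n : ℕ) → Fin n → ℂ

/-- The array is `μ`-distributed: `(1/n) ∑ᵢ δ_{a n i}` converges weakly to `μ`. -/
def TriangularArray.IsDistributed (a : TriangularArray) (μ : ProbabilityMeasure ℂ) : Prop :=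
  Tendsto (fun n : ℕ => uniformMeasure (Finset.univ.val.map (a n))) atTop (𝓝 μ.toFiniteMeasure)

/-- The array is log-Cesàro bounded: the row means of `log₊ |a n i|` are bounded. -/
def TriangularArray.IsLogCesaroBounded (a : TriangularArray) : Prop :=
  ∃ C : ℝ, ∀ n : ℕ, 1 ≤ n → (1 / (n : ℝ)) * ∑ i : Fin n, Real.posLog ‖a n i‖ ≤ C

/-- `log₊ (1 / |z - w|)`, with value `+∞` for `z = w`. -/
def logPlusInvDist (z w : ℂ) : ℝ≥0∞ :=
  open Classical in if z = w then ⊤ else ENNReal.ofReal (Real.posLog (1 / ‖z - w‖))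

/-- The random polynomial `(z - x₁) ⋯ (z - xₙ)` with zeros the entries of a finite row `x`. -/
def polyOfZeros {n : ℕ} (x : Fin n → ℂ) : Polynomial ℂ :=
  ∏ i : Fin n, (Polynomial.X - Polynomial.C (x i))

/-- The random elements `X n` of a topological space converge in probability to the
deterministic limit `x`: every neighbourhood of `x` contains `X n` with probability
tending to `1`. -/
def TendstoInProbability {Ω E : Type*} [MeasurableSpace Ω] [TopologicalSpace E]
    (P : Measure Ω) (X : ℕ → Ω → E) (x : E) : Prop :=
  ∀ U ∈ 𝓝 x, Tendsto (fun n => P {ω | X n ω ∉ U}) atTop (𝓝 0)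

end

/-! By Jensen's formula the logarithmic Mahler measure of p on the circle |z - c| = r is log|p(c)|
plus the truncated potential ∑ log₊(r/|w - c|) over the zeros w of p. Mahler's inequality M(p') ≤
deg p · M(p), rescaled to this circle and iterated, therefore bounds the truncated potential at c of
the zeros of p^(k) by that of the zeros of p, plus k log(n/r), plus log|p(c)/p^(k)(c)|. All that is
needed from randomness is that p^(k)(c)/p(c) is not exponentially small for most c.

For p = P_n this ratio is k! times the k-th elementary symmetric function of the numbers 1/(c -
ξ_i). The hypotheses leave arbitrarily many pairs that are bounded and at distance at least e^{-δn},
for every δ > 0. The Littlewood–Offord inequality, carried from sums to symmetric functions by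
decoupling, then makes the ratio at least (e^{-δn}/C)^k with probability close to 1, for every c
that is not an atom. By Fubini, with high probability the exceptional c fill only a small area.
Averaging the potentials against a compactly supported f ≥ 0 gives ∑ f(zeros of P_n^(k)) ≤ ∑ f(ξ_i)
+ εn.

Mahler's inequality on the unit circle bounds the log₊ moments of the zeros of P_n^(k), so no mass
escapes to infinity and the bound extends to bounded continuous f ≥ 0. Applied to ‖f‖ + f and ‖f‖ -
f, it becomes two-sided because the number of zeros is known.

Finally ∑ f(ξ_i) concentrates by Hoeffding's inequality; the exponential rate gives almost sure
convergence for P_n by Borel–Cantelli, whatever the joint law of the rows. All probabilities are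
obtained by counting the 2^n choices in a row. -/

/-! ### Mahler's inequality for the derivative -/

namespace Polynomial

/-- The polynomial obtained from `p` by reflecting the zeros outside the closed unit disc in the
unit circle; it has the same modulus as `p` on the unit circle. -/
noncomputable def reflectZeros (p : ℂ[X]) : ℂ[X] :=
  C p.leadingCoeff * (p.roots.map fun w =>
    if ‖w‖ ≤ 1 then X - C w else C (-(starRingEnd ℂ) w) * X + 1).prod

/-- Factor by factor, |1 - w̄z|² - |z - w|² = (|z|² - 1)(|w|² - 1), which is nonnegative when z and
w both lie outside the open unit disc. -/
theorem norm_eval_le_norm_eval_reflectZeros (p : ℂ[X]) {z : ℂ} (hz : 1 ≤ ‖z‖) :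
    ‖p.eval z‖ ≤ ‖p.reflectZeros.eval z‖ := by
  have hsplit := (IsAlgClosed.splits p).eq_prod_roots
  conv_lhs => rw [hsplit]
  rw [reflectZeros, eval_mul, eval_mul, norm_mul, norm_mul, eval_C]
  gcongr
  rw [eval_multiset_prod, eval_multiset_prod, Multiset.map_map, Multiset.map_map]
  generalize p.roots = s
  induction s using Multiset.induction_on with
  | empty => simp
  | cons w s ih =>
    simp only [Multiset.map_cons, Multiset.prod_cons, norm_mul]
    refine mul_le_mul ?_ ih (norm_nonneg _) (norm_nonneg _)
    simp only [Function.comp_apply]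
    split_ifs with hw
    · exact le_rfl
    · have h1 : 1 ≤ z.re ^ 2 + z.im ^ 2 := by
        have := Complex.sq_norm z
        rw [Complex.normSq_apply] at this
        nlinarith
      have h2 : 1 ≤ w.re ^ 2 + w.im ^ 2 := by
        have := Complex.sq_norm w
        rw [Complex.normSq_apply] at this
        nlinarith
      refine le_of_sq_le_sq ?_ (norm_nonneg _)
      rw [Complex.sq_norm, Complex.sq_norm, Complex.normSq_apply, Complex.normSq_apply]
      simp
      nlinarith [mul_nonneg (sub_nonneg.2 h1) (sub_nonneg.2 h2)]

theorem norm_le_one_of_isRoot_reflectZeros {p : ℂ[X]} (hp : p ≠ 0) {z : ℂ}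
    (hz : p.reflectZeros.eval z = 0) : ‖z‖ ≤ 1 := by
  rw [reflectZeros, eval_mul, eval_C, mul_eq_zero] at hz
  rcases hz with h | h
  · exact absurd (leadingCoeff_eq_zero.1 h) hp
  rw [eval_multiset_prod, Multiset.prod_eq_zero_iff, Multiset.map_map, Multiset.mem_map] at h
  obtain ⟨w, -, hw⟩ := h
  simp only [Function.comp_apply] at hw
  split_ifs at hw with h1
  · simp only [eval_sub, eval_X, eval_C, sub_eq_zero] at hw
    rwa [hw]
  · simp only [eval_add, eval_mul, eval_C, eval_X, eval_one] at hw
    have h3 : (starRingEnd ℂ) w * z = 1 := by linear_combination -hw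
    have h4 : ‖w‖ * ‖z‖ = 1 := by
      rw [← RCLike.norm_conj w, ← norm_mul, h3, norm_one]
    push Not at h1
    nlinarith [norm_nonneg z]

/-- A reflected factor has leading coefficient of modulus |w|, so reflection moves the whole Mahler
measure, |lead| ∏ max(1, |w|), into the leading coefficient. -/
theorem natDegree_reflectZeros_and_norm_leadingCoeff (p : ℂ[X]) :
    p.reflectZeros.natDegree = p.natDegree ∧
      ‖p.reflectZeros.leadingCoeff‖ = p.mahlerMeasure := by
  by_cases hp : p = 0
  · simp [hp, reflectZeros]
  have key : ∀ s : Multiset ℂ,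
      ((s.map fun w => if ‖w‖ ≤ 1 then (X - C w : ℂ[X])
        else C (-(starRingEnd ℂ) w) * X + 1).prod).natDegree = s.card ∧
      ‖((s.map fun w => if ‖w‖ ≤ 1 then (X - C w : ℂ[X])
        else C (-(starRingEnd ℂ) w) * X + 1).prod).leadingCoeff‖ =
        (s.map fun w => max 1 ‖w‖).prod := by
    intro s
    induction s using Multiset.induction_on with
    | empty => simp
    | cons w s ih =>
      have hs : ((s.map fun w => if ‖w‖ ≤ 1 then (X - C w : ℂ[X])
        else C (-(starRingEnd ℂ) w) * X + 1).prod) ≠ 0 := by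
        intro h
        rw [h] at ih
        have h2 := ih.2
        simp only [leadingCoeff_zero, norm_zero] at h2
        have : 0 < (s.map fun w : ℂ => max 1 ‖w‖).prod := by
          apply Multiset.prod_induction (fun x : ℝ => 0 < x)
          · intro a b ha hb; positivity
          · exact one_pos
          · intro a ha
            obtain ⟨w, -, rfl⟩ := Multiset.mem_map.1 ha
            positivity
        linarith
      have hfac : (if ‖w‖ ≤ 1 then (X - C w : ℂ[X])
          else C (-(starRingEnd ℂ) w) * X + 1).natDegree = 1 ∧
          ‖(if ‖w‖ ≤ 1 then (X - C w : ℂ[X])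
          else C (-(starRingEnd ℂ) w) * X + 1).leadingCoeff‖ = max 1 ‖w‖ := by
        split_ifs with h1
        · simp [h1]
        · have hw : -(starRingEnd ℂ) w ≠ 0 := by
            intro h
            have : w = 0 := by simpa using h
            simp [this] at h1
          have e : (C (-(starRingEnd ℂ) w) * X + 1 : ℂ[X]) =
            C (-(starRingEnd ℂ) w) * X + C 1 := by simp
          rw [e]
          refine ⟨natDegree_linear hw, ?_⟩
          rw [leadingCoeff_linear hw, norm_neg, RCLike.norm_conj, max_eq_right]
          exact (not_le.1 h1).le
      have hf : (if ‖w‖ ≤ 1 then (X - C w : ℂ[X])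
          else C (-(starRingEnd ℂ) w) * X + 1) ≠ 0 := by
        intro h
        have := hfac.1
        rw [h] at this
        simp at this
      rw [Multiset.map_cons, Multiset.prod_cons, natDegree_mul hf hs, leadingCoeff_mul, norm_mul,
        hfac.1, hfac.2, ih.1, ih.2]
      simp [add_comm]
  have hl : p.leadingCoeff ≠ 0 := leadingCoeff_ne_zero.2 hp
  rw [reflectZeros]
  refine ⟨?_, ?_⟩
  · rw [natDegree_C_mul hl, (key _).1]
    exact (IsAlgClosed.splits p).natDegree_eq_card_roots.symm
  · rw [leadingCoeff_mul, leadingCoeff_C, norm_mul, (key _).2,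
      mahlerMeasure_eq_leadingCoeff_mul_prod_roots]

/-- Gauss–Lucas: the critical points lie in the convex hull of the zeros, hence in the disc. -/
theorem norm_le_one_of_isRoot_derivative {p : ℂ[X]} (hdeg : 0 < p.natDegree)
    (h : ∀ z, p.eval z = 0 → ‖z‖ ≤ 1) {z : ℂ} (hz : p.derivative.eval z = 0) : ‖z‖ ≤ 1 := by
  have hp : 0 < p.degree := natDegree_pos_iff_degree_pos.1 hdeg
  have hd : p.derivative ≠ 0 := by
    intro h0
    have := derivative_eq_zero.1 h0
    omega
  have h1 := rootSet_derivative_subset_convexHull_rootSet hp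
    (show z ∈ p.derivative.rootSet ℂ by simp [mem_rootSet, hd, hz])
  have h2 : convexHull ℝ (p.rootSet ℂ) ⊆ Metric.closedBall 0 1 := by
    refine convexHull_min ?_ (convex_closedBall 0 1)
    intro w hw
    rw [mem_rootSet, coe_aeval_eq_eval] at hw
    simpa using h w hw.2
  simpa using h2 h1

/-- **De Bruijn's inequality**: if the zeros of `q` lie in the closed unit disc and `|p| ≤ |q|`
off the open disc, then `|p'| ≤ |q'|` outside the closed disc. -/
theorem norm_eval_derivative_le {p q : ℂ[X]} (hdeg : p.natDegree = q.natDegree)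
    (hq : 0 < q.natDegree) (hlead : ‖p.leadingCoeff‖ ≤ ‖q.leadingCoeff‖)
    (hroots : ∀ z, q.eval z = 0 → ‖z‖ ≤ 1)
    (hle : ∀ z, 1 ≤ ‖z‖ → ‖p.eval z‖ ≤ ‖q.eval z‖) {z : ℂ} (hz : 1 < ‖z‖) :
    ‖p.derivative.eval z‖ ≤ ‖q.derivative.eval z‖ := by
  by_contra! hlt
  have hq' : q.derivative.eval z ≠ 0 := fun h =>
    absurd (norm_le_one_of_isRoot_derivative hq hroots h) (not_le.2 hz)
  -- Since |l| > 1, the polynomial p - l q has no zero outside the closed disc, and its leading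
  -- terms do not cancel. Gauss–Lucas forbids its derivative to vanish at z, but l is chosen so that
  -- it does.
  set l := p.derivative.eval z / q.derivative.eval z with hl
  have hl1 : 1 < ‖l‖ := by
    rw [hl, norm_div, one_lt_div (norm_pos_iff.2 hq')]
    exact hlt
  have hqlead : 0 < ‖q.leadingCoeff‖ := by
    rw [norm_pos_iff, leadingCoeff_ne_zero]
    rintro rfl
    simp at hq
  have hcoeff : (p - C l * q).coeff q.natDegree ≠ 0 := by
    rw [coeff_sub, coeff_C_mul, ← hdeg, coeff_natDegree, hdeg, coeff_natDegree, sub_ne_zero]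
    intro h
    have := congrArg norm h
    rw [norm_mul] at this
    nlinarith
  refine absurd (norm_le_one_of_isRoot_derivative (p := p - C l * q) ?_ ?_ (z := z) ?_)
    (not_le.2 hz)
  · exact hq.trans_le (le_natDegree_of_ne_zero hcoeff)
  · intro w hw
    by_contra! hw1
    rw [eval_sub, eval_mul, eval_C, sub_eq_zero] at hw
    have h1 := hle w hw1.le
    rw [hw, norm_mul] at h1
    have h2 : 0 < ‖q.eval w‖ := norm_pos_iff.2 fun h => absurd (hroots w h) (not_le.2 hw1)
    nlinarith
  · simp only [derivative_sub, derivative_mul, derivative_C, zero_mul, zero_add, eval_sub,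
      eval_mul, eval_C, hl]
    field_simp
    ring

theorem mahlerMeasure_le_of_norm_eval_le {p q : ℂ[X]} (hq : q ≠ 0)
    (h : ∀ z, ‖z‖ = 1 → ‖p.eval z‖ ≤ ‖q.eval z‖) : p.mahlerMeasure ≤ q.mahlerMeasure := by
  by_cases hp : p = 0
  · simpa [hp] using q.mahlerMeasure_nonneg
  rw [mahlerMeasure_def_of_ne_zero hp, mahlerMeasure_def_of_ne_zero hq]
  gcongr
  refine intervalIntegral.integral_mono_ae (by positivity) p.intervalIntegrable_mahlerMeasure
    q.intervalIntegrable_mahlerMeasure ?_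
  -- As `Real.log 0 = 0`, the comparison of logarithms may fail at zeros of p; these occupy only
  -- countably many angles.
  have hc : (circleMap 0 1 ⁻¹' {z : ℂ | p.eval z = 0}).Countable := by
    refine Set.Countable.preimage_circleMap ?_ 0 one_ne_zero
    refine (Set.Finite.countable (p.rootSet_finite ℂ)).mono ?_
    intro z hz
    simpa [mem_rootSet, hp] using hz
  have hae : ∀ᵐ θ : ℝ, θ ∉ circleMap 0 1 ⁻¹' {z : ℂ | p.eval z = 0} :=
    measure_eq_zero_iff_ae_notMem.1 (hc.measure_zero _)
  filter_upwards [hae] with θ hθ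
  exact Real.log_le_log (norm_pos_iff.2 hθ) (h _ (by simp))

/-- **Mahler's inequality** for the Mahler measure of a derivative. -/
theorem mahlerMeasure_derivative_le (p : ℂ[X]) :
    p.derivative.mahlerMeasure ≤ p.natDegree * p.mahlerMeasure := by
  rcases Nat.eq_zero_or_pos p.natDegree with h0 | hpos
  · rw [derivative_of_natDegree_zero h0]
    simp [h0]
  have hp : p ≠ 0 := by rintro rfl; simp at hpos
  set q := p.reflectZeros with hqdef
  obtain ⟨hdeg, hlead⟩ := natDegree_reflectZeros_and_norm_leadingCoeff p
  rw [← hqdef] at hdeg hlead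
  have hroots : ∀ z, q.eval z = 0 → ‖z‖ ≤ 1 := fun z => norm_le_one_of_isRoot_reflectZeros hp
  have hqpos : 0 < q.natDegree := by omega
  have hlt : ∀ z : ℂ, 1 < ‖z‖ → ‖p.derivative.eval z‖ ≤ ‖q.derivative.eval z‖ := fun z hz =>
    norm_eval_derivative_le hdeg.symm hqpos
      (by rw [hlead]; exact leadingCoeff_le_mahlerMeasure p) hroots
      (fun z hz => norm_eval_le_norm_eval_reflectZeros p hz) hz
  -- De Bruijn's inequality is available only strictly outside the disc; it passes to the circle by
  -- radial approach.
  have hle : ∀ z : ℂ, ‖z‖ = 1 → ‖p.derivative.eval z‖ ≤ ‖q.derivative.eval z‖ := by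
    intro z hz
    have hcl : z ∈ closure {w : ℂ | 1 < ‖w‖} := by
      refine mem_closure_of_tendsto (f := fun n : ℕ => ((1 : ℂ) + 1 / ((n : ℂ) + 1)) * z)
        (b := atTop) ?_ (Eventually.of_forall fun n => ?_)
      · have := (tendsto_one_div_add_atTop_nhds_zero_nat (𝕜 := ℂ)).const_add (1 : ℂ)
        simpa using this.mul_const z
      · have e : ((1 : ℂ) + 1 / ((n : ℂ) + 1)) = ((1 + 1 / ((n : ℝ) + 1) : ℝ) : ℂ) := by
          push_cast; ring
        simp only [Set.mem_ofPred_eq, norm_mul, hz, e, Complex.norm_real, mul_one]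
        rw [Real.norm_of_nonneg (by positivity)]
        have : 0 < 1 / ((n : ℝ) + 1) := by positivity
        linarith
    exact closure_minimal (s := {w : ℂ | 1 < ‖w‖})
      (t := {w | ‖p.derivative.eval w‖ ≤ ‖q.derivative.eval w‖}) (fun w hw => hlt w hw)
      (isClosed_le (by fun_prop) (by fun_prop)) hcl
  have hq' : q.derivative ≠ 0 := by
    intro h
    have := derivative_eq_zero.1 h
    omega
  refine (mahlerMeasure_le_of_norm_eval_le hq' hle).trans ?_
  -- The zeros of q' stay in the disc, so M(q') = |lead q'| = n |lead q| = n M(p).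
  rw [mahlerMeasure_eq_leadingCoeff_mul_prod_roots]
  have h1 : (q.derivative.roots.map fun a => max 1 ‖a‖).prod = 1 := by
    refine Multiset.prod_eq_one fun x hx => ?_
    obtain ⟨a, ha, rfl⟩ := Multiset.mem_map.1 hx
    exact max_eq_left (norm_le_one_of_isRoot_derivative hqpos hroots (isRoot_of_mem_roots ha))
  have h2 : ‖q.derivative.leadingCoeff‖ = q.natDegree * ‖q.leadingCoeff‖ := by
    have hnd : q.derivative.natDegree = q.natDegree - 1 := natDegree_derivative q
    rw [leadingCoeff, hnd, coeff_derivative, Nat.sub_add_cancel hqpos, norm_mul, mul_comm]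
    congr 1
    rw [← Nat.cast_succ, Nat.succ_eq_add_one, Nat.sub_add_cancel hqpos, Complex.norm_natCast]
  rw [h1, mul_one, h2, hdeg, hlead]

end Polynomial
-- Mahler measure on general circles and truncated logarithmic potentials
namespace Polynomial

theorem mahlerMeasure_comp_linear (p : ℂ[X]) (c : ℂ) {r : ℝ} (hr : 0 < r) :
    (p.comp (C (r : ℂ) * X + C c)).mahlerMeasure =
      ‖p.leadingCoeff‖ * (p.roots.map fun w => max r ‖w - c‖).prod := by
  have hsplit := (IsAlgClosed.splits p).eq_prod_roots
  conv_lhs => rw [hsplit]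
  rw [mul_comp, mahlerMeasure_mul, C_comp, mahlerMeasure_const, multiset_prod_comp,
    prod_mahlerMeasure_eq_mahlerMeasure_prod, Multiset.map_map, Multiset.map_map]
  congr 3
  ext w
  have hr' : (r : ℂ) ≠ 0 := by exact_mod_cast hr.ne'
  have e : (X - C w : ℂ[X]).comp (C (r : ℂ) * X + C c) = C (r : ℂ) * X + C (c - w) := by
    simp only [sub_comp, X_comp, C_comp, C_sub]; ring
  simp only [Function.comp_apply]
  rw [e, mahlerMeasure_C_mul_X_add_C hr', Complex.norm_real, Real.norm_of_nonneg hr.le,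
    norm_sub_rev w c]

theorem natDegree_comp_linear (p : ℂ[X]) (c : ℂ) {r : ℝ} (hr : 0 < r) :
    (p.comp (C (r : ℂ) * X + C c)).natDegree = p.natDegree := by
  have hr' : (r : ℂ) ≠ 0 := by exact_mod_cast hr.ne'
  rw [natDegree_comp, natDegree_linear hr', mul_one]

/-- Mahler's inequality transported to the circle |z - c| = r: by the chain rule each
differentiation yields one factor r. -/
theorem mahlerMeasure_iterate_derivative_comp_le (p : ℂ[X]) (c : ℂ) {r : ℝ} (hr : 0 < r)
    (k : ℕ) :
    r ^ k * ((derivative^[k] p).comp (C (r : ℂ) * X + C c)).mahlerMeasure ≤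
      (p.natDegree : ℝ) ^ k * (p.comp (C (r : ℂ) * X + C c)).mahlerMeasure := by
  induction k with
  | zero => simp
  | succ k ih =>
    set q := derivative^[k] p with hq
    have hdeg : q.natDegree ≤ p.natDegree := (natDegree_iterate_derivative p k).trans (by omega)
    have h := mahlerMeasure_derivative_le (q.comp (C (r : ℂ) * X + C c))
    rw [derivative_comp, mahlerMeasure_mul, natDegree_comp_linear _ _ hr] at h
    simp only [derivative_add, derivative_mul, derivative_C, zero_mul, derivative_X, mul_one,
      zero_add, add_zero, mahlerMeasure_const, Complex.norm_real, Real.norm_of_nonneg hr.le] at h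
    rw [Function.iterate_succ_apply', ← hq]
    calc r ^ (k + 1) * ((derivative q).comp (C (r : ℂ) * X + C c)).mahlerMeasure
        = r ^ k * (r * ((derivative q).comp (C (r : ℂ) * X + C c)).mahlerMeasure) := by ring
      _ ≤ r ^ k * (q.natDegree * (q.comp (C (r : ℂ) * X + C c)).mahlerMeasure) := by gcongr
      _ ≤ r ^ k * (p.natDegree * (q.comp (C (r : ℂ) * X + C c)).mahlerMeasure) := by
          have := (q.comp (C (r : ℂ) * X + C c)).mahlerMeasure_nonneg
          gcongr
      _ = p.natDegree * (r ^ k * (q.comp (C (r : ℂ) * X + C c)).mahlerMeasure) := by ring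
      _ ≤ p.natDegree * ((p.natDegree : ℝ) ^ k *
            (p.comp (C (r : ℂ) * X + C c)).mahlerMeasure) := by gcongr
      _ = _ := by ring

end Polynomial

theorem max_eq_mul_exp_posLog {r x : ℝ} (hr : 0 < r) (hx : 0 < x) :
    max r x = x * Real.exp (Real.posLog (r / x)) := by
  rw [Real.posLog_eq_log_max_one (by positivity), Real.exp_log (by positivity),
    mul_max_of_nonneg _ _ hx.le, mul_one, mul_div_cancel₀ _ hx.ne', max_comm]

namespace Polynomial

/-- This is Jensen's formula, since max(r, |w - c|) = |w - c| exp(log₊(r/|w - c|)). -/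
theorem mahlerMeasure_comp_linear_of_eval_ne_zero {p : ℂ[X]} {c : ℂ} {r : ℝ} (hr : 0 < r)
    (hc : p.eval c ≠ 0) :
    (p.comp (C (r : ℂ) * X + C c)).mahlerMeasure =
      ‖p.eval c‖ * Real.exp (p.roots.map fun w => Real.posLog (r / ‖w - c‖)).sum := by
  have hp : p ≠ 0 := by rintro rfl; simp at hc
  have hev : ‖p.eval c‖ = ‖p.leadingCoeff‖ * (p.roots.map fun w => ‖w - c‖).prod := by
    conv_lhs => rw [(IsAlgClosed.splits p).eq_prod_roots]
    rw [eval_mul, eval_C, norm_mul, eval_multiset_prod, Multiset.map_map]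
    congr 1
    generalize p.roots = s
    induction s using Multiset.induction_on with
    | empty => simp
    | cons w s ih =>
      rw [Multiset.map_cons, Multiset.prod_cons, Multiset.map_cons, Multiset.prod_cons, norm_mul, ih]
      simp [norm_sub_rev]
  rw [mahlerMeasure_comp_linear p c hr, hev, mul_assoc]
  congr 1
  have hne : ∀ w ∈ p.roots, 0 < ‖w - c‖ := by
    intro w hw
    rw [norm_pos_iff, sub_ne_zero]
    rintro rfl
    exact hc (isRoot_of_mem_roots hw)
  generalize p.roots = s at hne
  induction s using Multiset.induction_on with
  | empty => simp
  | cons w s ih =>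
    simp only [Multiset.map_cons, Multiset.prod_cons, Multiset.sum_cons, Real.exp_add]
    rw [ih fun v hv => hne v (Multiset.mem_cons_of_mem hv),
      max_eq_mul_exp_posLog hr (hne w (Multiset.mem_cons_self w s))]
    ring

/-- One-sided comparison of the truncated logarithmic potentials of the zeros of a polynomial and
of its `k`-th derivative at a point where the derivative is not too small. -/
theorem sum_posLog_roots_iterate_derivative_le {p : ℂ[X]} {c : ℂ} {r D : ℝ} {k : ℕ} (hr : 0 < r)
    (hpos : 0 < p.natDegree) (hc : p.eval c ≠ 0)
    (hD : Real.exp (-D) * ‖p.eval c‖ ≤ ‖(derivative^[k] p).eval c‖) :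
    ((derivative^[k] p).roots.map fun w => Real.posLog (r / ‖w - c‖)).sum ≤
      (p.roots.map fun w => Real.posLog (r / ‖w - c‖)).sum
        + k * Real.log (p.natDegree / r) + D := by
  have hpc : 0 < ‖p.eval c‖ := norm_pos_iff.2 hc
  have hn : (0 : ℝ) < p.natDegree := by exact_mod_cast hpos
  have hq : (derivative^[k] p).eval c ≠ 0 := by
    rw [← norm_pos_iff]
    exact lt_of_lt_of_le (by positivity) hD
  have h := mahlerMeasure_iterate_derivative_comp_le p c hr k
  rw [mahlerMeasure_comp_linear_of_eval_ne_zero hr hc,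
    mahlerMeasure_comp_linear_of_eval_ne_zero hr hq] at h
  set S := ((derivative^[k] p).roots.map fun w => Real.posLog (r / ‖w - c‖)).sum
  set T := (p.roots.map fun w => Real.posLog (r / ‖w - c‖)).sum
  have h1 : r ^ k * (Real.exp (-D) * ‖p.eval c‖ * Real.exp S) ≤
      (p.natDegree : ℝ) ^ k * (‖p.eval c‖ * Real.exp T) := le_trans (by gcongr) h
  have h2 : r ^ k * Real.exp (-D) * Real.exp S ≤ (p.natDegree : ℝ) ^ k * Real.exp T := by
    refine le_of_mul_le_mul_right ?_ hpc
    linarith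
  have h3 := Real.log_le_log (by positivity) h2
  rw [Real.log_mul (by positivity) (by positivity), Real.log_mul (by positivity) (by positivity),
    Real.log_mul (by positivity) (by positivity), Real.log_pow, Real.log_pow, Real.log_exp,
    Real.log_exp, Real.log_exp] at h3
  rw [Real.log_div hn.ne' hr.ne']
  linarith

theorem log_prod_max_one_eq (s : Multiset ℂ) :
    0 < (s.map fun w : ℂ => max 1 ‖w‖).prod ∧
    Real.log (s.map fun w : ℂ => max 1 ‖w‖).prod = (s.map fun w => Real.posLog ‖w‖).sum := by
  induction s using Multiset.induction_on with
  | empty => simp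
  | cons w s ih =>
    have h1 : 0 < max 1 ‖w‖ := by positivity
    simp only [Multiset.map_cons, Multiset.prod_cons, Multiset.sum_cons]
    refine ⟨mul_pos h1 ih.1, ?_⟩
    rw [Real.log_mul h1.ne' ih.1.ne', ih.2, Real.posLog_eq_log_max_one (norm_nonneg w)]

/-- The zeros of the derivatives of a monic polynomial inherit log-Cesàro bounds. -/
theorem sum_posLog_norm_roots_iterate_derivative_le {p : ℂ[X]} {k : ℕ} (hp : p.Monic)
    (hk : k < p.natDegree) :
    ((derivative^[k] p).roots.map fun w => Real.posLog ‖w‖).sum ≤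
      (p.roots.map fun w => Real.posLog ‖w‖).sum + k * Real.log p.natDegree := by
  have h := mahlerMeasure_iterate_derivative_comp_le p 0 one_pos k
  rw [mahlerMeasure_comp_linear _ _ one_pos, mahlerMeasure_comp_linear _ _ one_pos] at h
  simp only [one_pow, one_mul, sub_zero, hp.leadingCoeff, norm_one] at h
  have hdeg : (derivative^[k] p).natDegree ≤ p.natDegree - k := natDegree_iterate_derivative p k
  have hco : (derivative^[k] p).coeff (p.natDegree - k) =
      ((p.natDegree.descFactorial k : ℕ) : ℂ) := by
    rw [coeff_iterate_derivative, Nat.sub_add_cancel hk.le, coeff_natDegree, hp.leadingCoeff]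
    simp
  have hdf : 1 ≤ p.natDegree.descFactorial k :=
    Nat.one_le_iff_ne_zero.2 (by rw [Ne, Nat.descFactorial_eq_zero_iff_lt]; omega)
  have hdeg' : (derivative^[k] p).natDegree = p.natDegree - k := by
    refine le_antisymm hdeg (le_natDegree_of_ne_zero ?_)
    rw [hco]
    exact_mod_cast (by omega : p.natDegree.descFactorial k ≠ 0)
  -- The Mahler measure contains the leading coefficient n(n-1)⋯(n-k+1); being at least 1, it may be
  -- dropped.
  have hlead : 1 ≤ ‖(derivative^[k] p).leadingCoeff‖ := by
    rw [leadingCoeff, hdeg', hco, Complex.norm_natCast]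
    exact_mod_cast hdf
  obtain ⟨h1, h2⟩ := log_prod_max_one_eq (derivative^[k] p).roots
  obtain ⟨h3, h4⟩ := log_prod_max_one_eq p.roots
  have hn : (0 : ℝ) < p.natDegree := by exact_mod_cast (by omega : 0 < p.natDegree)
  have h5 : ((derivative^[k] p).roots.map fun w : ℂ => max 1 ‖w‖).prod ≤
      (p.natDegree : ℝ) ^ k * (p.roots.map fun w : ℂ => max 1 ‖w‖).prod :=
    le_trans (le_mul_of_one_le_left h1.le hlead) h
  have h6 := Real.log_le_log h1 h5
  rw [Real.log_mul (by positivity) h3.ne', Real.log_pow, h2, h4] at h6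
  linarith

theorem natDegree_iterate_derivative_eq (p : ℂ[X]) (k : ℕ) :
    (derivative^[k] p).natDegree = p.natDegree - k := by
  induction k with
  | zero => simp
  | succ k ih => rw [Function.iterate_succ_apply', natDegree_derivative, ih]; omega

end Polynomial
-- Littlewood–Offord–Erdős on the discrete cube
-- Squared form of C(2j, j) ≤ 4^j / √(2j + 1). The induction closes because (2j + 1)(2j + 3) ≤ 4(j +
-- 1)².
theorem sq_centralBinom_mul_le (j : ℕ) : j.centralBinom ^ 2 * (2 * j + 1) ≤ 16 ^ j := by
  induction j with
  | zero => simp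
  | succ j ih =>
    have h := Nat.succ_mul_centralBinom_succ j
    have h1 : (j + 1) ^ 2 * ((j + 1).centralBinom ^ 2 * (2 * (j + 1) + 1)) ≤
        (j + 1) ^ 2 * 16 ^ (j + 1) := by
      calc (j + 1) ^ 2 * ((j + 1).centralBinom ^ 2 * (2 * (j + 1) + 1))
          = ((j + 1) * (j + 1).centralBinom) ^ 2 * (2 * j + 3) := by ring
        _ = (4 * ((2 * j + 1) * (2 * j + 3))) * (j.centralBinom ^ 2 * (2 * j + 1)) := by
            rw [h]; ring
        _ ≤ (4 * (4 * (j + 1) ^ 2)) * 16 ^ j := by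
            exact Nat.mul_le_mul (by nlinarith) ih
        _ = (j + 1) ^ 2 * 16 ^ (j + 1) := by ring
    exact Nat.le_of_mul_le_mul_left h1 (by positivity)

theorem sq_choose_half_mul_le (m : ℕ) : m.choose (m / 2) ^ 2 * (m + 1) ≤ 4 ^ m := by
  rcases Nat.even_or_odd' m with ⟨j, rfl | rfl⟩
  · have := sq_centralBinom_mul_le j
    rw [Nat.centralBinom_eq_two_mul_choose] at this
    rw [Nat.mul_div_cancel_left _ two_pos, pow_mul]
    exact this
  · have h := sq_centralBinom_mul_le (j + 1)
    have e : (j + 1).centralBinom = 2 * (2 * j + 1).choose j := by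
      rw [Nat.centralBinom_eq_two_mul_choose, show 2 * (j + 1) = 2 * j + 1 + 1 by ring,
        Nat.choose_succ_succ, Nat.choose_symm_half]
      ring
    rw [e] at h
    rw [show (2 * j + 1) / 2 = j by omega]
    have h16 : (16 : ℕ) ^ (j + 1) = 4 * 4 ^ (2 * j + 1) := by
      rw [show (16 : ℕ) = 4 ^ 2 by norm_num, ← pow_mul, ← pow_succ']
      congr 1
    rw [h16] at h
    nlinarith [sq_nonneg ((2 * j + 1).choose j)]

theorem exists_forall_choose_half_le {ε : ℝ} (hε : 0 < ε) :
    ∃ M : ℕ, ∀ m ≥ M, (m.choose (m / 2) : ℝ) ≤ ε * 2 ^ m := by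
  obtain ⟨M, hM⟩ := exists_nat_ge (1 / ε ^ 2)
  refine ⟨M, fun m hm => ?_⟩
  have h : ((m.choose (m / 2) : ℝ)) ^ 2 * (m + 1) ≤ 4 ^ m := by
    exact_mod_cast sq_choose_half_mul_le m
  have hm' : 1 / ε ^ 2 ≤ m + 1 := by
    have : (M : ℝ) ≤ m := by exact_mod_cast hm
    linarith
  refine le_of_sq_le_sq ?_ (by positivity)
  rw [mul_pow, ← pow_mul, mul_comm m 2, pow_mul]
  norm_num
  rw [div_le_iff₀ (by positivity)] at hm'
  nlinarith [sq_nonneg (m.choose (m / 2) : ℝ), mul_le_mul_of_nonneg_left hm'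
    (sq_nonneg (m.choose (m / 2) : ℝ)), mul_le_mul_of_nonneg_left h (sq_nonneg ε)]

section Cube

variable {ι : Type} [DecidableEq ι]

/-- The point of a discrete cube with prescribed coordinates in `J` and off `J`. -/
def cubeGlue (J : Finset ι) (u : {i // i ∈ J} → Bool) (t : {i // i ∉ J} → Bool) : ι → Bool :=
  (Equiv.piEquivPiSubtypeProd (· ∈ J) fun _ => Bool).symm (u, t)

theorem cubeGlue_mem (J : Finset ι) (u : {i // i ∈ J} → Bool) (t : {i // i ∉ J} → Bool)
    (i : {i // i ∈ J}) : cubeGlue J u t i = u i := by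
  simp [cubeGlue, Equiv.piEquivPiSubtypeProd]

theorem cubeGlue_notMem (J : Finset ι) (u : {i // i ∈ J} → Bool) (t : {i // i ∉ J} → Bool)
    (i : {i // i ∉ J}) : cubeGlue J u t i = t i := by
  simp [cubeGlue, Equiv.piEquivPiSubtypeProd, i.2]

variable [Fintype ι]

open Classical in
theorem card_filter_cube_eq_sum (J : Finset ι) (B : (ι → Bool) → Prop) :
    (Finset.univ.filter B).card = ∑ u, (Finset.univ.filter fun t => B (cubeGlue J u t)).card := by
  rw [Finset.card_filter,
    ← (Equiv.piEquivPiSubtypeProd (· ∈ J) fun _ => Bool).symm.sum_comp, Fintype.sum_prod_type]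
  simp_rw [Finset.card_filter]
  rfl

open Classical in
theorem card_filter_cube_eq_sum' (J : Finset ι) (B : (ι → Bool) → Prop) :
    (Finset.univ.filter B).card = ∑ t, (Finset.univ.filter fun u => B (cubeGlue J u t)).card := by
  rw [card_filter_cube_eq_sum J]
  simp_rw [Finset.card_filter]
  exact Finset.sum_comm

theorem card_cube_split (J : Finset ι) :
    (2 : ℝ) ^ Fintype.card ι =
      2 ^ Fintype.card {i // i ∈ J} * 2 ^ Fintype.card {i // i ∉ J} := by
  rw [← pow_add]
  congr 1
  have := Fintype.card_subtype_compl (fun i => i ∈ J)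
  have h2 := Fintype.card_subtype_le (fun i => i ∈ J)
  omega

open Classical in
-- Conditioning: a bound uniform in the coordinates off J persists after averaging over them. The
-- `classical` instances make the counts independent of decidability choices.
theorem card_filter_cube_le (J : Finset ι) (B : (ι → Bool) → Prop) {ε : ℝ}
    (h : ∀ t, ((Finset.univ.filter fun u => B (cubeGlue J u t)).card : ℝ) ≤
      ε * 2 ^ Fintype.card {i // i ∈ J}) :
    ((Finset.univ.filter B).card : ℝ) ≤ ε * 2 ^ Fintype.card ι := by
  rw [card_filter_cube_eq_sum' J, card_cube_split J]
  push_cast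
  calc _ ≤ ∑ _t : {i // i ∉ J} → Bool, ε * 2 ^ Fintype.card {i // i ∈ J} :=
        Finset.sum_le_sum fun t _ => h t
    _ = _ := by
        rw [Finset.sum_const, Finset.card_univ, Fintype.card_fun, Fintype.card_bool, nsmul_eq_mul]
        push_cast
        ring

theorem sum_cubeGlue {R : Type*} [AddCommMonoid R] (J : Finset ι) (z : ι → Bool → R)
    (u : {i // i ∈ J} → Bool) (t : {i // i ∉ J} → Bool) :
    ∑ i, z i (cubeGlue J u t i) =
      ∑ i : {i // i ∈ J}, z i (u i) + ∑ i : {i // i ∉ J}, z i (t i) := by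
  rw [← Fintype.sum_subtype_add_sum_subtype (· ∈ J)]
  simp_rw [cubeGlue_mem, cubeGlue_notMem]
  congr!

theorem prod_cubeGlue {R : Type*} [CommMonoid R] (J : Finset ι) (z : ι → Bool → R)
    (u : {i // i ∈ J} → Bool) (t : {i // i ∉ J} → Bool) :
    ∏ i, z i (cubeGlue J u t i) =
      (∏ i : {i // i ∈ J}, z i (u i)) * ∏ i : {i // i ∉ J}, z i (t i) := by
  rw [← Fintype.prod_subtype_mul_prod_subtype (· ∈ J)]
  simp_rw [cubeGlue_mem, cubeGlue_notMem]
  congr!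

open Classical in
/-- The Littlewood–Offord–Erdős inequality on the real line. -/
theorem card_abs_sum_sub_lt_le {x : ι → Bool → ℝ} {δ : ℝ} (hδ : 0 < δ)
    (h : ∀ i, δ ≤ |x i true - x i false|) (c : ℝ) :
    (Finset.univ.filter fun s : ι → Bool => |∑ i, x i (s i) - c| < δ / 2).card ≤
      (Fintype.card ι).choose (Fintype.card ι / 2) := by
  -- A choice s is encoded by the coordinates where it takes the larger value. If up s is strictly
  -- contained in up t, the sum for t exceeds that for s by at least δ, while both lie in an open
  -- interval of length δ. So the encodings form an antichain and Sperner's theorem applies.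
  set up : (ι → Bool) → Finset ι := fun s => Finset.univ.filter fun i => x i (!s i) < x i (s i)
    with hup
  have hsep : ∀ i b, x i b ≠ x i (!b) := by
    intro i b hb
    have := h i
    cases b <;> simp_all <;> linarith
  have hinj : Function.Injective up := by
    intro s t hst
    ext i
    have h1 : i ∈ up s ↔ i ∈ up t := by rw [hst]
    simp only [hup, Finset.mem_filter, Finset.mem_univ, true_and] at h1
    rcases lt_or_gt_of_ne (hsep i true) with h2 | h2 <;>
      cases hs : s i <;> cases ht : t i <;> rw [hs, ht] at h1 <;>
      simp only [Bool.not_true, Bool.not_false] at h1 h2 <;>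
      first
      | rfl
      | exact absurd (h1.1 h2) (lt_asymm h2)
      | exact absurd (h1.2 h2) (lt_asymm h2)
  have hanti : IsAntichain (· ⊆ ·)
      (((Finset.univ.filter fun s : ι → Bool => |∑ i, x i (s i) - c| < δ / 2).image up :
        Finset (Finset ι)) : Set (Finset ι)) := by
    intro A hA B hB hAB hsub
    simp only [Finset.coe_image, Set.mem_image, Finset.mem_coe, Finset.mem_filter,
      Finset.mem_univ, true_and] at hA hB
    obtain ⟨s, hs, rfl⟩ := hA
    obtain ⟨t, ht, rfl⟩ := hB
    have hmono : ∀ i, x i (s i) ≤ x i (t i) := by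
      intro i
      by_cases hi : i ∈ up s
      · have h2 := hsub hi
        simp only [hup, Finset.mem_filter, Finset.mem_univ, true_and] at hi h2
        cases hs : s i <;> cases ht : t i <;> simp_all <;> linarith
      · simp only [hup, Finset.mem_filter, Finset.mem_univ, true_and, not_lt] at hi
        cases hs : s i <;> cases ht : t i <;> simp_all
    obtain ⟨i, hit, his⟩ := Finset.exists_of_ssubset (lt_of_le_of_ne hsub hAB)
    have hi : x i (s i) + δ ≤ x i (t i) := by
      simp only [hup, Finset.mem_filter, Finset.mem_univ, true_and, not_lt] at hit his
      have := h i
      have h3 := le_abs'.1 this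
      cases hs : s i <;> cases ht : t i <;> simp_all
      · linarith
      · rcases h3 with h3 | h3 <;> linarith
      · rcases h3 with h3 | h3 <;> linarith
      · linarith
    have hsum : ∑ i, x i (s i) + δ ≤ ∑ i, x i (t i) := by
      rw [← Finset.sum_erase_add _ _ (Finset.mem_univ i),
        ← Finset.sum_erase_add (a := i) _ (fun i => x i (t i)) (Finset.mem_univ i), add_assoc]
      exact add_le_add (Finset.sum_le_sum fun j _ => hmono j) hi
    rw [abs_lt] at hs ht
    linarith [hs.1, ht.2]
  rw [← Finset.card_image_of_injective _ hinj]
  exact hanti.sperner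

end Cube
-- Small ball estimates for sums and for elementary symmetric functions
section SmallBall

open Classical in
theorem card_norm_sum_sub_lt_le_of_addMonoidHom {ι : Type} [Fintype ι] [DecidableEq ι]
    {z : ι → Bool → ℂ} {δ ε : ℝ} (hδ : 0 < δ) (φ : ℂ →+ ℝ) (hφ : ∀ w, |φ w| ≤ ‖w‖) (J : Finset ι)
    (hJ : ((J.card.choose (J.card / 2) : ℕ) : ℝ) ≤ ε * 2 ^ J.card)
    (h : ∀ i ∈ J, δ / 2 ≤ |φ (z i true - z i false)|) (c : ℂ) :
    ((Finset.univ.filter fun s : ι → Bool => ‖∑ i, z i (s i) - c‖ < δ / 4).card : ℝ) ≤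
      ε * 2 ^ Fintype.card ι := by
  refine card_filter_cube_le J _ fun t => ?_
  have hcard : Fintype.card {i // i ∈ J} = J.card := Fintype.card_coe J
  have h1 := card_abs_sum_sub_lt_le (x := fun (i : {i // i ∈ J}) b => φ (z i b)) (half_pos hδ)
    (fun i => by rw [← map_sub]; exact h i i.2)
    (φ (c - ∑ i : {i // i ∉ J}, z i (t i)))
  rw [hcard] at h1 ⊢
  refine le_trans ?_ hJ
  rw [Nat.cast_le]
  refine le_trans (Finset.card_le_card ?_) h1
  intro u hu
  simp only [Finset.mem_filter, Finset.mem_univ, true_and] at hu ⊢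
  rw [sum_cubeGlue] at hu
  rw [← map_sum, ← map_sub]
  refine lt_of_le_of_lt (hφ _) ?_
  rw [show δ / 2 / 2 = δ / 4 by ring]
  refine lt_of_eq_of_lt ?_ hu
  congr 1
  ring

open Classical in
/-- A qualitative Littlewood–Offord inequality in the complex plane. -/
theorem exists_card_norm_sum_sub_lt_le {ε : ℝ} (hε : 0 < ε) :
    ∃ M : ℕ, ∀ (ι : Type) [Fintype ι] [DecidableEq ι], M ≤ Fintype.card ι →
      ∀ (z : ι → Bool → ℂ) (δ : ℝ), 0 < δ → (∀ i, δ ≤ ‖z i true - z i false‖) → ∀ c : ℂ,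
      ((Finset.univ.filter fun s : ι → Bool => ‖∑ i, z i (s i) - c‖ < δ / 4).card : ℝ) ≤
        ε * 2 ^ Fintype.card ι := by
  obtain ⟨M, hM⟩ := exists_forall_choose_half_le hε
  refine ⟨2 * M, fun ι _ _ hcard z δ hδ h c => ?_⟩
  -- Each difference has real or imaginary part at least δ/2 in modulus, so one of the two
  -- projections serves at least M of the 2M or more indices.
  set J := Finset.univ.filter fun i => δ / 2 ≤ |(z i true - z i false).re| with hJ
  by_cases hJM : M ≤ J.card
  · refine card_norm_sum_sub_lt_le_of_addMonoidHom hδ Complex.reAddGroupHom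
      Complex.abs_re_le_norm J (hM _ hJM) (fun i hi => ?_) c
    simpa [hJ] using hi
  · refine card_norm_sum_sub_lt_le_of_addMonoidHom hδ Complex.imAddGroupHom
      Complex.abs_im_le_norm Jᶜ (hM _ ?_) (fun i hi => ?_) c
    · rw [Finset.card_compl]; omega
    · have hi' : |(z i true - z i false).re| < δ / 2 := by
        rw [Finset.mem_compl, hJ] at hi
        simpa using hi
      have h1 := Complex.norm_le_abs_re_add_abs_im (z i true - z i false)
      have h2 := h i
      change δ / 2 ≤ |(z i true - z i false).im|
      linarith

open Polynomial

theorem coeff_zero_prod_one_add {ι : Type} [Fintype ι] (x : ι → ℂ) :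
    (∏ i, (1 + C (x i) * X) : ℂ[X]).coeff 0 = 1 := by
  rw [coeff_zero_eq_eval_zero, eval_prod]
  simp

theorem coeff_one_prod_one_add {ι : Type} [Fintype ι] (x : ι → ℂ) :
    (∏ i, (1 + C (x i) * X) : ℂ[X]).coeff 1 = ∑ i, x i := by
  classical
  have key : ∀ s : Finset ι, (∏ i ∈ s, (1 + C (x i) * X) : ℂ[X]).coeff 0 = 1 ∧
      (∏ i ∈ s, (1 + C (x i) * X) : ℂ[X]).coeff 1 = ∑ i ∈ s, x i := by
    intro s
    induction s using Finset.induction_on with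
    | empty => simp [coeff_one]
    | insert a s ha ih =>
      rw [Finset.prod_insert ha, Finset.sum_insert ha]
      refine ⟨?_, ?_⟩
      · rw [mul_coeff_zero, ih.1]; simp
      · rw [add_mul, one_mul, coeff_add, mul_assoc, coeff_C_mul, coeff_X_mul, ih.1, ih.2]
        ring
  exact (key Finset.univ).2

/-- Small ball probability under decoupling: Cauchy–Schwarz for a bipartite relation. -/
theorem sq_card_filter_prod_le {α β : Type} [Fintype α] [Fintype β] (B : α → β → Prop)
    [∀ u, DecidablePred (B u)] :
    (∑ u, ((Finset.univ.filter (B u)).card : ℝ)) ^ 2 ≤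
      Fintype.card α * ∑ t, ∑ t', ((Finset.univ.filter fun u => B u t ∧ B u t').card : ℝ) := by
  have h := sq_sum_le_card_mul_sum_sq (s := (Finset.univ : Finset α))
    (f := fun u => ((Finset.univ.filter (B u)).card : ℝ))
  refine h.trans (le_of_eq ?_)
  rw [Finset.card_univ]
  congr 1
  have h1 : ∀ t t', ((Finset.univ.filter fun u => B u t ∧ B u t').card : ℝ) =
      ∑ u, (if B u t then (1 : ℝ) else 0) * (if B u t' then 1 else 0) := by
    intro t t'
    rw [Finset.card_filter]
    push_cast
    refine Finset.sum_congr rfl fun u _ => ?_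
    by_cases h1 : B u t <;> by_cases h2 : B u t' <;> simp [h1, h2]
  simp_rw [h1]
  rw [Finset.sum_congr rfl fun t _ => Finset.sum_comm, Finset.sum_comm]
  refine Finset.sum_congr rfl fun u _ => ?_
  rw [sq, Finset.card_filter]
  push_cast
  rw [Finset.sum_mul_sum]

open Classical in
/-- Small ball estimate for the coefficients of a random product of linear factors. -/
theorem exists_card_norm_coeff_prod_lt_le (k : ℕ) : ∀ {ε : ℝ}, 0 < ε →
    ∃ M : ℕ, ∀ (ι : Type) [Fintype ι] [DecidableEq ι], M ≤ Fintype.card ι →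
      ∀ (z : ι → Bool → ℂ) (δ β : ℝ), 0 < δ → 0 < β → (∀ i, δ ≤ ‖z i true - z i false‖) →
      ∀ A : ℂ[X], β ≤ ‖A.coeff 0‖ →
      ((Finset.univ.filter fun s : ι → Bool =>
        ‖(A * ∏ i, (1 + C (z i (s i)) * X)).coeff k‖ < β * (δ / 8) ^ k).card : ℝ) ≤
        ε * 2 ^ Fintype.card ι := by
  induction k with
  | zero =>
    intro ε hε
    refine ⟨0, fun ι _ _ _ z δ β hδ hβ h A hA => ?_⟩
    rw [Finset.filter_false_of_mem]
    · simp; positivity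
    · intro s _
      rw [mul_coeff_zero, coeff_zero_prod_one_add, mul_one, pow_zero, mul_one, not_lt]
      exact hA
  | succ k ih =>
    intro ε hε
    have hε' : 0 < ε ^ 2 / 2 := by positivity
    obtain ⟨M₁, hM₁⟩ := exists_card_norm_sum_sub_lt_le hε'
    obtain ⟨M₂, hM₂⟩ := ih hε'
    refine ⟨M₁ + M₂, fun ι _ _ hcard z δ β hδ hβ h A hA => ?_⟩
    -- Decoupling: the choice splits into u on J and t off J. By Cauchy–Schwarz it suffices that the
    -- event rarely holds for both t and t' with the same u. The two errors ε²/2 add up to ε², and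
    -- the square root restores ε.
    obtain ⟨J, -, hJ⟩ := Finset.exists_subset_card_eq
      (s := (Finset.univ : Finset ι)) (n := M₂) (by rw [Finset.card_univ]; omega)
    have hcJ : Fintype.card {i // i ∈ J} = M₂ := by rw [Fintype.card_coe, hJ]
    have hcJ' : M₁ ≤ Fintype.card {i // i ∉ J} := by
      have := Fintype.card_subtype_compl (fun i => i ∈ J)
      omega
    set a : ℝ := 2 ^ Fintype.card {i // i ∈ J} with ha
    set b : ℝ := 2 ^ Fintype.card {i // i ∉ J} with hb
    set QX : ({i // i ∈ J} → Bool) → ℂ[X] := fun u => ∏ i : {i // i ∈ J}, (1 + C (z i (u i)) * X) with hQX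
    set QY : ({i // i ∉ J} → Bool) → ℂ[X] := fun t => ∏ i : {i // i ∉ J}, (1 + C (z i (t i)) * X) with hQY
    set r : ℝ := β * (δ / 8) ^ (k + 1) with hr
    -- Subtraction cancels the constant terms: QY t - QY t' = D X, where D(0) is a difference of
    -- linear sums. The (k+1)-st coefficient becomes the k-th one of A D QX, so the induction
    -- hypothesis applies with A D in place of A; this is why a general A is carried along. The
    -- thresholds match: β(δ/4)(δ/8)^k = 2r.
    have hsmall : ∀ t t' : {i // i ∉ J} → Bool,
        δ / 4 ≤ ‖∑ i : {i // i ∉ J}, z i (t i) - ∑ i : {i // i ∉ J}, z i (t' i)‖ →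
        ((Finset.univ.filter fun u => ‖(A * (QX u * QY t)).coeff (k + 1)‖ < r ∧
          ‖(A * (QX u * QY t')).coeff (k + 1)‖ < r).card : ℝ) ≤ ε ^ 2 / 2 * a := by
      intro t t' htt
      set D := divX (QY t - QY t') with hD
      have hD0 : D.coeff 0 =
          ∑ i : {i // i ∉ J}, z i (t i) - ∑ i : {i // i ∉ J}, z i (t' i) := by
        rw [hD, coeff_divX, zero_add, coeff_sub, hQY]
        simp only [coeff_one_prod_one_add]
      have hDX : QY t - QY t' = D * X := by
        have := divX_mul_X_add (QY t - QY t')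
        rw [← this, coeff_sub, hQY]
        simp [coeff_zero_prod_one_add, hD, hQY]
      have h3 := hM₂ {i // i ∈ J} hcJ.ge (fun i => z i) δ (β * (δ / 4)) hδ (by positivity)
        (fun i => h i) (A * D) (by
          rw [mul_coeff_zero, norm_mul, hD0]
          gcongr)
      refine le_trans (Nat.cast_le.2 (Finset.card_le_card ?_)) h3
      intro u hu
      simp only [Finset.mem_filter, Finset.mem_univ, true_and] at hu ⊢
      have e : (A * D * QX u).coeff k =
          (A * (QX u * QY t)).coeff (k + 1) - (A * (QX u * QY t')).coeff (k + 1) := by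
        rw [← coeff_sub, ← coeff_mul_X]
        congr 1
        linear_combination (-A * QX u) * hDX
      change ‖(A * D * QX u).coeff k‖ < _
      rw [e]
      refine lt_of_le_of_lt (norm_sub_le _ _) (lt_of_lt_of_eq (add_lt_add hu.1 hu.2) ?_)
      rw [hr]
      ring
    have hN := sq_card_filter_prod_le
      (fun (u : {i // i ∈ J} → Bool) t => ‖(A * (QX u * QY t)).coeff (k + 1)‖ < r)
    have hcount : ((Finset.univ.filter fun s : ι → Bool =>
        ‖(A * ∏ i, (1 + C (z i (s i)) * X)).coeff (k + 1)‖ < r).card : ℝ) =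
        ∑ u, ((Finset.univ.filter fun t =>
          ‖(A * (QX u * QY t)).coeff (k + 1)‖ < r).card : ℝ) := by
      rw [card_filter_cube_eq_sum J]
      push_cast
      refine Finset.sum_congr rfl fun u _ => ?_
      congr 2
      ext t
      have e := prod_cubeGlue J (fun i b => (1 + C (z i b) * X : ℂ[X])) u t
      simp only [Finset.mem_filter, Finset.mem_univ, true_and]
      rw [show ∏ i, (1 + C (z i (cubeGlue J u t i)) * X) = QX u * QY t from e]
    have hinner : ∀ t' : {i // i ∉ J} → Bool,
        ∑ t, ((Finset.univ.filter fun u => ‖(A * (QX u * QY t)).coeff (k + 1)‖ < r ∧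
          ‖(A * (QX u * QY t')).coeff (k + 1)‖ < r).card : ℝ) ≤ ε ^ 2 * a * b := by
      intro t'
      have hlin := hM₁ {i // i ∉ J} hcJ' (fun i => z i) δ hδ (fun i => h i)
        (∑ i : {i // i ∉ J}, z i (t' i))
      rw [← hb] at hlin
      calc _ ≤ ∑ t : {i // i ∉ J} → Bool, (ε ^ 2 / 2 * a +
            a * if ‖∑ i : {i // i ∉ J}, z i (t i) - ∑ i : {i // i ∉ J}, z i (t' i)‖ < δ / 4
              then 1 else 0) := by
            refine Finset.sum_le_sum fun t _ => ?_
            split_ifs with hlt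
            · have h1 : ((Finset.univ.filter fun u => ‖(A * (QX u * QY t)).coeff (k + 1)‖ < r ∧
                  ‖(A * (QX u * QY t')).coeff (k + 1)‖ < r).card : ℝ) ≤ a := by
                have := Finset.card_le_univ (Finset.univ.filter fun u =>
                  ‖(A * (QX u * QY t)).coeff (k + 1)‖ < r ∧
                  ‖(A * (QX u * QY t')).coeff (k + 1)‖ < r)
                rw [Fintype.card_fun, Fintype.card_bool] at this
                rw [ha]
                exact_mod_cast this
              have : 0 ≤ ε ^ 2 / 2 * a := by positivity
              linarith
            · rw [mul_zero, add_zero]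
              exact hsmall t t' (not_lt.1 hlt)
        _ = b * (ε ^ 2 / 2 * a) + a * ((Finset.univ.filter fun t : {i // i ∉ J} → Bool =>
              ‖∑ i : {i // i ∉ J}, z i (t i) - ∑ i : {i // i ∉ J}, z i (t' i)‖ < δ / 4).card
                : ℝ) := by
            rw [Finset.sum_add_distrib, ← Finset.mul_sum, Finset.sum_const, Finset.card_univ,
              Fintype.card_fun, Fintype.card_bool, nsmul_eq_mul, Finset.card_filter]
            push_cast
            rw [Finset.mul_sum]
            ring
        _ ≤ b * (ε ^ 2 / 2 * a) + a * (ε ^ 2 / 2 * b) := by gcongr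
        _ = ε ^ 2 * a * b := by ring
    rw [← hcount] at hN
    rw [card_cube_split J]
    refine le_of_sq_le_sq ?_ (by positivity)
    refine hN.trans ?_
    have hca : (Fintype.card ({i // i ∈ J} → Bool) : ℝ) = a := by
      rw [Fintype.card_fun, Fintype.card_bool, ha]; push_cast; rfl
    have hcb : (Fintype.card ({i // i ∉ J} → Bool) : ℝ) = b := by
      rw [Fintype.card_fun, Fintype.card_bool, hb]; push_cast; rfl
    rw [hca, Finset.sum_comm]
    calc _ ≤ a * ∑ _t' : {i // i ∉ J} → Bool, ε ^ 2 * a * b := by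
          gcongr with t'
          exact hinner t'
      _ = _ := by
          rw [Finset.sum_const, Finset.card_univ, nsmul_eq_mul, hcb]
          ring

end SmallBall
-- The kernel log₊(r/|w|) and smoothing of potentials
section Potential

theorem measurable_posLog : Measurable Real.posLog := by
  unfold Real.posLog
  fun_prop

theorem measurable_posLog_div_norm (r : ℝ) : Measurable fun w : ℂ => Real.posLog (r / ‖w‖) :=
  measurable_posLog.comp (by fun_prop)

theorem posLog_div_eq_zero {r x : ℝ} (hr : 0 < r) (hx : r ≤ x) : Real.posLog (r / x) = 0 := by
  have hx0 : 0 < x := hr.trans_le hx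
  rw [Real.posLog_eq_zero_iff, abs_of_pos (by positivity), div_le_one hx0]
  exact hx

theorem mul_posLog_div_le {r x : ℝ} (hr : 0 < r) (hx : 0 < x) : x * Real.posLog (r / x) ≤ r := by
  have h : Real.posLog (r / x) ≤ r / x := by
    rw [Real.posLog_def]
    refine max_le (by positivity) ?_
    have := Real.log_le_sub_one_of_pos (div_pos hr hx)
    linarith
  calc x * Real.posLog (r / x) ≤ x * (r / x) := by gcongr
    _ = r := by field_simp

/-- In polar coordinates the Jacobian absorbs the singularity: y log₊(r/y) is at most r, and it
vanishes for y ≥ r. -/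
theorem integrable_posLog_div_norm {r : ℝ} (hr : 0 < r) :
    Integrable fun w : ℂ => Real.posLog (r / ‖w‖) := by
  rw [integrable_fun_norm_addHaar (μ := (volume : Measure ℂ)) (f := fun x => Real.posLog (r / x)),
    Complex.finrank_real_complex]
  have h1 : IntegrableOn (fun y : ℝ => Set.indicator (Set.Iio r) (fun _ => r) y) (Set.Ioi 0) := by
    rw [IntegrableOn, integrable_indicator_iff measurableSet_Iio, IntegrableOn,
      Measure.restrict_restrict measurableSet_Iio]
    refine integrableOn_const ?_
    rw [Set.inter_comm, Set.Ioi_inter_Iio]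
    exact measure_Ioo_lt_top.ne
  refine Integrable.mono' h1 ?_ ?_
  · exact (Measurable.mul (by fun_prop)
      (measurable_posLog.comp (by fun_prop))).aestronglyMeasurable
  · filter_upwards [ae_restrict_mem measurableSet_Ioi] with y hy
    have hy0 : 0 < y := hy
    simp only [smul_eq_mul]
    rw [Real.norm_of_nonneg (mul_nonneg (by positivity) Real.posLog_nonneg), pow_one]
    by_cases hyr : y < r
    · rw [Set.indicator_of_mem (show y ∈ Set.Iio r from hyr)]
      exact mul_posLog_div_le hr hy0
    · rw [Set.indicator_of_notMem (show y ∉ Set.Iio r from hyr),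
        posLog_div_eq_zero hr (not_lt.1 hyr), mul_zero]

theorem integral_posLog_div_norm_pos {r : ℝ} (hr : 0 < r) :
    0 < ∫ w : ℂ, Real.posLog (r / ‖w‖) := by
  rw [integral_pos_iff_support_of_nonneg (fun w => Real.posLog_nonneg)
    (integrable_posLog_div_norm hr)]
  have hsub : Metric.ball (0 : ℂ) r \ {0} ⊆
      Function.support fun w : ℂ => Real.posLog (r / ‖w‖) := by
    intro w hw
    have hw0 : 0 < ‖w‖ := norm_pos_iff.2 hw.2
    have hwr : ‖w‖ < r := by simpa using hw.1
    rw [Function.mem_support, Ne, Real.posLog_eq_zero_iff, abs_of_pos (by positivity), not_le,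
      one_lt_div hw0]
    exact hwr
  refine lt_of_lt_of_le ?_ (measure_mono hsub)
  rw [measure_sdiff_null (by simp)]
  exact Metric.measure_ball_pos _ _ hr

/-- Truncating the kernel at height m costs little mass and makes the contribution of an exceptional
set proportional to its area. -/
theorem tendsto_integral_min_posLog {r : ℝ} (hr : 0 < r) :
    Tendsto (fun m : ℕ => ∫ w : ℂ, min (Real.posLog (r / ‖w‖)) m) atTop
      (𝓝 (∫ w : ℂ, Real.posLog (r / ‖w‖))) := by
  refine tendsto_integral_of_dominated_convergence (fun w : ℂ => Real.posLog (r / ‖w‖))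
    (fun m => ((measurable_posLog_div_norm r).min measurable_const).aestronglyMeasurable)
    (integrable_posLog_div_norm hr) (fun m => Eventually.of_forall fun w => ?_)
    (Eventually.of_forall fun w => ?_)
  · rw [Real.norm_of_nonneg (le_min Real.posLog_nonneg (Nat.cast_nonneg m))]
    exact min_le_left _ _
  · refine tendsto_const_nhds.congr' ?_
    obtain ⟨M, hM⟩ := exists_nat_ge (Real.posLog (r / ‖w‖))
    filter_upwards [eventually_ge_atTop M] with m hm
    have : (M : ℝ) ≤ m := by exact_mod_cast hm
    rw [min_eq_left (hM.trans this)]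

theorem integral_multiset_sum_map {α β : Type*} [MeasurableSpace α] {ν : Measure α}
    (S : Multiset β) (g : β → α → ℝ) (hg : ∀ w, Integrable (g w) ν) :
    Integrable (fun c => (S.map fun w => g w c).sum) ν ∧
      ∫ c, (S.map fun w => g w c).sum ∂ν = (S.map fun w => ∫ c, g w c ∂ν).sum := by
  induction S using Multiset.induction_on with
  | empty => simp
  | cons w S ih =>
    simp only [Multiset.map_cons, Multiset.sum_cons]
    exact ⟨(hg w).add ih.1, by rw [integral_add (hg w) ih.1, ih.2]⟩

/-- Smoothing: an almost everywhere comparison of truncated logarithmic potentials of two finite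
configurations, outside a small exceptional set, yields a comparison of the configurations on
slowly varying nonnegative test functions. -/
theorem sum_le_of_sum_posLog_le {f : ℂ → ℝ} {B ρ r η m Δ : ℝ} {N : ℕ} {S W : Multiset ℂ}
    {E : Set ℂ} (hf : Continuous f) (hf0 : ∀ c, 0 ≤ f c) (hfB : ∀ c, f c ≤ B)
    (hfρ : ∀ c, c ∉ Metric.closedBall (0 : ℂ) ρ → f c = 0) (hr : 0 < r) (hη : 0 ≤ η)
    (hmod : ∀ x y, ‖x - y‖ < r → f x ≤ f y + η) (hm : 0 ≤ m) (hS : S.card ≤ N) (hW : W.card = N)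
    (hΔ : 0 ≤ Δ) (hE : MeasurableSet E)
    (h : ∀ᵐ c : ℂ, c ∉ E → (S.map fun w => Real.posLog (r / ‖w - c‖)).sum ≤
      (W.map fun w => Real.posLog (r / ‖w - c‖)).sum + Δ) :
    (∫ w : ℂ, min (Real.posLog (r / ‖w‖)) m) * ((S.map f).sum - N * η) ≤
      (∫ w : ℂ, Real.posLog (r / ‖w‖)) * ((W.map f).sum + N * η) + Δ * (∫ c, f c) +
        B * N * m * volume.real (E ∩ Metric.closedBall 0 ρ) := by
  set K := Metric.closedBall (0 : ℂ) ρ with hK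
  set κ : ℂ → ℝ := fun w => Real.posLog (r / ‖w‖) with hκ
  -- Only the potential of S is truncated: on E nothing else bounds it, whereas off E the estimate T
  -- ≤ κ allows the hypothesis to be used.
  set T : ℂ → ℝ := fun w => min (κ w) m with hT
  have hκ0 : ∀ w, 0 ≤ κ w := fun w => Real.posLog_nonneg
  have hκi : Integrable κ := integrable_posLog_div_norm hr
  have hT0 : ∀ w, 0 ≤ T w := fun w => le_min (hκ0 w) hm
  have hTκ : ∀ w, T w ≤ κ w := fun w => min_le_left _ _
  have hTi : Integrable T := hκi.mono'
    ((measurable_posLog_div_norm r).min measurable_const).aestronglyMeasurable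
    (Eventually.of_forall fun w => by rw [Real.norm_of_nonneg (hT0 w)]; exact hTκ w)
  have hκfar : ∀ w c, ¬ ‖w - c‖ < r → κ (w - c) = 0 := fun w c hwc =>
    posLog_div_eq_zero hr (not_lt.1 hwc)
  have hTfar : ∀ w c, ¬ ‖w - c‖ < r → T (w - c) = 0 := fun w c hwc => by
    simp only [hT]
    rw [hκfar w c hwc, min_eq_left hm]
  have hKm : MeasurableSet K := measurableSet_closedBall
  have hKfin : volume K ≠ ∞ := measure_closedBall_lt_top.ne
  have hB : 0 ≤ B := (hf0 0).trans (hfB 0)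
  have hfi : Integrable f := by
    have : f = K.indicator f := by
      ext c
      by_cases hc : c ∈ K
      · rw [Set.indicator_of_mem hc]
      · rw [Set.indicator_of_notMem hc, hfρ c hc]
    rw [this, integrable_indicator_iff hKm]
    exact hf.continuousOn.integrableOn_compact (isCompact_closedBall 0 ρ)
  have hbd : ∀ g : ℂ → ℝ, Integrable g → ∀ w, Integrable fun c => f c * g (w - c) := by
    intro g hg w
    refine (hg.comp_sub_left w).bdd_mul hf.aestronglyMeasurable
      (c := B) (Eventually.of_forall fun c => ?_)
    rw [Real.norm_of_nonneg (hf0 c)]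
    exact hfB c
  -- Both kernels vanish at distance r or more, so f varies by at most η where they matter.
  have hlow : ∀ w, (∫ c, T c) * (f w - η) ≤ ∫ c, f c * T (w - c) := by
    intro w
    rw [← integral_sub_left_eq_self T volume w, ← integral_mul_const]
    refine integral_mono ((hTi.comp_sub_left w).mul_const _) (hbd T hTi w) fun c => ?_
    by_cases hwc : ‖w - c‖ < r
    · have := hmod w c hwc
      simp only
      rw [mul_comm]
      exact mul_le_mul_of_nonneg_right (by linarith) (hT0 _)
    · simp [hTfar w c hwc]
  have hup : ∀ w, ∫ c, f c * κ (w - c) ≤ (∫ c, κ c) * (f w + η) := by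
    intro w
    rw [← integral_sub_left_eq_self κ volume w, ← integral_mul_const]
    refine integral_mono (hbd κ hκi w) ((hκi.comp_sub_left w).mul_const _) fun c => ?_
    by_cases hwc : ‖w - c‖ < r
    · have := hmod c w (by rwa [norm_sub_rev])
      simp only
      rw [mul_comm]
      exact mul_le_mul_of_nonneg_left (by linarith) (hκ0 _)
    · simp [hκfar w c hwc]
  obtain ⟨hSi, hSe⟩ := integral_multiset_sum_map S (fun w c => f c * T (w - c)) (hbd T hTi)
  obtain ⟨hWi, hWe⟩ := integral_multiset_sum_map W (fun w c => f c * κ (w - c)) (hbd κ hκi)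
  have hS1 : (∫ c, T c) * ((S.map f).sum - N * η) ≤
      (S.map fun w => ∫ c, f c * T (w - c)).sum := by
    have h1 := Multiset.sum_map_le_sum_map _ _ fun w (_ : w ∈ S) => hlow w
    refine le_trans ?_ h1
    rw [Multiset.sum_map_mul_left, Multiset.sum_map_sub, Multiset.map_const', Multiset.sum_replicate,
      nsmul_eq_mul]
    have h2 : (S.card : ℝ) ≤ N := by exact_mod_cast hS
    have h3 : 0 ≤ ∫ c, T c := integral_nonneg hT0
    gcongr
  have hW1 : (W.map fun w => ∫ c, f c * κ (w - c)).sum ≤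
      (∫ c, κ c) * ((W.map f).sum + N * η) := by
    have h1 := Multiset.sum_map_le_sum_map _ _ fun w (_ : w ∈ W) => hup w
    refine h1.trans (le_of_eq ?_)
    rw [Multiset.sum_map_mul_left, Multiset.sum_map_add, Multiset.map_const', Multiset.sum_replicate,
      nsmul_eq_mul, hW]
  have hind : Integrable ((E ∩ K).indicator fun _ : ℂ => B * N * m) := by
    rw [integrable_indicator_iff (hE.inter hKm)]
    exact integrableOn_const (ne_top_of_le_ne_top hKfin (measure_mono Set.inter_subset_right))
  have hmain : ∫ c, (S.map fun w => f c * T (w - c)).sum ≤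
      ∫ c, ((W.map fun w => f c * κ (w - c)).sum + Δ * f c +
        (E ∩ K).indicator (fun _ : ℂ => B * N * m) c) := by
    refine integral_mono_ae hSi ((hWi.add (hfi.const_mul Δ)).add hind) ?_
    filter_upwards [h] with c hc
    simp only [Multiset.sum_map_mul_left]
    have hWc : 0 ≤ (W.map fun w => κ (w - c)).sum :=
      Multiset.sum_nonneg fun x hx => by
        obtain ⟨w, -, rfl⟩ := Multiset.mem_map.1 hx
        exact hκ0 _
    have hind0 : 0 ≤ (E ∩ K).indicator (fun _ : ℂ => B * N * m) c :=
      Set.indicator_nonneg (fun _ _ => by positivity) c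
    by_cases hcK : c ∈ K
    · by_cases hcE : c ∈ E
      · rw [Set.indicator_of_mem (show c ∈ E ∩ K from ⟨hcE, hcK⟩)]
        have h1 : (S.map fun w => T (w - c)).sum ≤ N * m := by
          have h2 := Multiset.sum_map_le_sum_map (fun w => T (w - c)) (fun _ => m)
            fun w (_ : w ∈ S) => min_le_right _ _
          rw [Multiset.map_const', Multiset.sum_replicate, nsmul_eq_mul] at h2
          refine h2.trans ?_
          have h3 : (S.card : ℝ) ≤ N := by exact_mod_cast hS
          gcongr
        have h2 : f c * (S.map fun w => T (w - c)).sum ≤ B * (N * m) := by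
          refine mul_le_mul (hfB c) h1 ?_ hB
          exact Multiset.sum_nonneg fun x hx => by
            obtain ⟨w, -, rfl⟩ := Multiset.mem_map.1 hx
            exact hT0 _
        have h3 : 0 ≤ f c * (W.map fun w => κ (w - c)).sum := mul_nonneg (hf0 c) hWc
        have h4 : 0 ≤ Δ * f c := mul_nonneg hΔ (hf0 c)
        linarith
      · have h1 := Multiset.sum_map_le_sum_map (fun w => T (w - c)) (fun w => κ (w - c))
            fun w (_ : w ∈ S) => hTκ _
        have h2 := mul_le_mul_of_nonneg_left (h1.trans (hc hcE)) (hf0 c)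
        rw [mul_add] at h2
        linarith
    · rw [hfρ c hcK]
      simpa using hind0
  have e1 := integral_add (hWi.add (hfi.const_mul Δ)) hind
  have e2 := integral_add hWi (hfi.const_mul Δ)
  simp only [Pi.add_apply] at e1
  rw [e1, e2,
    integral_const_mul, integral_indicator (hE.inter hKm), setIntegral_const, hSe, hWe,
    smul_eq_mul] at hmain
  refine hS1.trans (hmain.trans ?_)
  refine le_trans (add_le_add (add_le_add hW1 le_rfl) le_rfl) (le_of_eq ?_)
  ring

end Potential
-- Logarithmic derivatives of a row polynomial at a point
section Rows

open Polynomial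

theorem polyOfZeros_monic {n : ℕ} (x : Fin n → ℂ) : (polyOfZeros x).Monic :=
  monic_prod_of_monic _ _ fun i _ => monic_X_sub_C (x i)

theorem natDegree_polyOfZeros {n : ℕ} (x : Fin n → ℂ) : (polyOfZeros x).natDegree = n := by
  rw [polyOfZeros, natDegree_prod_of_monic _ _ fun i _ => monic_X_sub_C (x i)]
  simp

theorem roots_polyOfZeros {n : ℕ} (x : Fin n → ℂ) :
    (polyOfZeros x).roots = Finset.univ.val.map x := by
  have : polyOfZeros x = ((Finset.univ.val.map x).map fun w => X - C w).prod := by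
    rw [Multiset.map_map]; rfl
  rw [this, roots_multiset_prod_X_sub_C]

theorem eval_polyOfZeros {n : ℕ} (x : Fin n → ℂ) (c : ℂ) :
    (polyOfZeros x).eval c = ∏ i, (c - x i) := by
  simp [polyOfZeros, eval_prod]

/-- The derivatives of a polynomial in terms of the reciprocals of the distances to its zeros. -/
theorem eval_iterate_derivative_polyOfZeros {n : ℕ} (x : Fin n → ℂ) {c : ℂ} (hc : ∀ i, c ≠ x i)
    (k : ℕ) :
    (derivative^[k] (polyOfZeros x)).eval c =
      k.factorial * ((polyOfZeros x).eval c *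
        (∏ i, (1 + C (c - x i)⁻¹ * X) : ℂ[X]).coeff k) := by
  -- Taylor expansion at c: each factor c + X - x_i equals (c - x_i)(1 + X/(c - x_i)).
  have h1 : taylor c (polyOfZeros x) =
      C ((polyOfZeros x).eval c) * ∏ i, (1 + C (c - x i)⁻¹ * X) := by
    rw [eval_polyOfZeros, polyOfZeros, taylor_apply, prod_comp, map_prod, ← Finset.prod_mul_distrib]
    refine Finset.prod_congr rfl fun i _ => ?_
    have hi : c - x i ≠ 0 := sub_ne_zero.2 (hc i)
    rw [mul_add, mul_one, ← mul_assoc, ← C_mul, mul_inv_cancel₀ hi, C_1, one_mul]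
    simp only [sub_comp, X_comp, C_comp, C_sub]
    ring
  have h2 : (hasseDeriv k (polyOfZeros x)).eval c =
      (polyOfZeros x).eval c * (∏ i, (1 + C (c - x i)⁻¹ * X) : ℂ[X]).coeff k := by
    rw [← taylor_coeff, h1, coeff_C_mul]
  rw [← h2, ← factorial_smul_hasseDeriv]
  simp

/-- With high probability the logarithmic derivatives of order `k` of a random polynomial are not
small at a given point. -/
theorem exists_card_norm_eval_iterate_derivative_lt_le (k : ℕ) {ε : ℝ} (hε : 0 < ε) :
    ∃ M : ℕ, ∀ (n : ℕ) (z : Fin n → Bool → ℂ) (J : Finset (Fin n)) (δ R : ℝ), M ≤ J.card →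
      0 < δ → (∀ i ∈ J, δ ≤ ‖z i true - z i false‖) → (∀ i ∈ J, ∀ b, ‖z i b‖ ≤ R) →
      ∀ c : ℂ, ∀ ρ : ℝ, ‖c‖ ≤ ρ → (∀ i b, c ≠ z i b) →
      ((Finset.univ.filter fun s : Fin n → Bool =>
        ‖(derivative^[k] (polyOfZeros fun i => z i (s i))).eval c‖ <
          (δ / (R + ρ) ^ 2 / 8) ^ k * ‖(polyOfZeros fun i => z i (s i)).eval c‖).card : ℝ) ≤
        ε * 2 ^ n := by
  classical
  obtain ⟨M, hM⟩ := exists_card_norm_coeff_prod_lt_le k hε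
  -- The extra 1 makes J nonempty, which forces R + ρ > 0.
  refine ⟨M + 1, fun n z J δ R hJ hδ hsep hR c ρ hρ hc => ?_⟩
  obtain ⟨i₀, hi₀⟩ := Finset.card_pos.1 (by omega : 0 < J.card)
  have hdist : ∀ i ∈ J, ∀ b, 0 < ‖c - z i b‖ ∧ ‖c - z i b‖ ≤ R + ρ := by
    intro i hi b
    refine ⟨norm_pos_iff.2 (sub_ne_zero.2 (hc i b)), ?_⟩
    have := norm_sub_le c (z i b)
    have := hR i hi b
    linarith
  have hRρ : 0 < R + ρ := (hdist i₀ hi₀ true).1.trans_le (hdist i₀ hi₀ true).2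
  have hsep' : ∀ i ∈ J, δ / (R + ρ) ^ 2 ≤ ‖(c - z i true)⁻¹ - (c - z i false)⁻¹‖ := by
    intro i hi
    obtain ⟨h1, h2⟩ := hdist i hi true
    obtain ⟨h3, h4⟩ := hdist i hi false
    rw [inv_sub_inv (sub_ne_zero.2 (hc i true)) (sub_ne_zero.2 (hc i false)), norm_div, norm_mul,
      show c - z i false - (c - z i true) = z i true - z i false by ring, sq]
    have := hsep i hi
    gcongr
  have hcard : Fintype.card (Fin n) = n := Fintype.card_fin n
  -- After conditioning, the fixed factors off J form the polynomial A, whose constant coefficient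
  -- is 1; hence β = 1.
  have hmain := card_filter_cube_le J (fun s : Fin n → Bool =>
    ‖(∏ i, (1 + C (c - z i (s i))⁻¹ * X) : ℂ[X]).coeff k‖ < 1 * (δ / (R + ρ) ^ 2 / 8) ^ k)
    (ε := ε) (fun t => by
      have h := hM {i // i ∈ J} (by rw [Fintype.card_coe]; omega)
        (fun i b => (c - z i b)⁻¹) (δ / (R + ρ) ^ 2) 1 (by positivity) one_pos
        (fun i => hsep' i i.2) (∏ i : {i // i ∉ J}, (1 + C (c - z i (t i))⁻¹ * X))
        (by rw [coeff_zero_prod_one_add]; simp)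
      refine le_trans (le_of_eq ?_) h
      congr 2
      ext u
      have e := prod_cubeGlue J (fun i b => (1 + C (c - z i b)⁻¹ * X : ℂ[X])) u t
      simp only [Finset.mem_filter, Finset.mem_univ, true_and]
      rw [show ∏ i, (1 + C (c - z i (cubeGlue J u t i))⁻¹ * X : ℂ[X]) = _ from e, mul_comm])
  rw [hcard] at hmain
  refine le_trans (Nat.cast_le.2 (Finset.card_le_card ?_)) hmain
  intro s hs
  simp only [Finset.mem_filter, Finset.mem_univ, true_and] at hs ⊢
  rw [eval_iterate_derivative_polyOfZeros _ (fun i => hc i (s i)), norm_mul, norm_mul,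
    Complex.norm_natCast] at hs
  have hp : 0 < ‖(polyOfZeros fun i => z i (s i)).eval c‖ := by
    rw [norm_pos_iff, eval_polyOfZeros, Finset.prod_ne_zero_iff]
    exact fun i _ => sub_ne_zero.2 (hc i (s i))
  have hk : (1 : ℝ) ≤ k.factorial := by exact_mod_cast Nat.succ_le_of_lt k.factorial_pos
  rw [one_mul]
  by_contra! hle
  refine absurd hs (not_lt.2 ?_)
  rw [mul_comm _ ‖(polyOfZeros fun i => z i (s i)).eval c‖]
  refine le_trans ?_ (le_mul_of_one_le_left (by positivity) hk)
  gcongr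

/-- The set of points where the `k`-th derivative of `p` is small compared with `p`. -/
def smallDerivSet (p : ℂ[X]) (k : ℕ) (θ : ℝ) : Set ℂ :=
  {c | ‖(derivative^[k] p).eval c‖ < θ * ‖p.eval c‖}

theorem measurableSet_smallDerivSet (p : ℂ[X]) (k : ℕ) (θ : ℝ) :
    MeasurableSet (smallDerivSet p k θ) :=
  (isOpen_lt (by fun_prop) (by fun_prop)).measurableSet

/-- Fubini followed by Markov: if every point of K is exceptional for few s, then few s have a large
exceptional set. -/
theorem card_volume_ge_le {α : Type} [Fintype α] (E : α → Set ℂ) (hE : ∀ s, MeasurableSet (E s))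
    [∀ c, DecidablePred fun s => c ∈ E s] {K : Set ℂ} (hK : MeasurableSet K)
    (hKfin : volume K ≠ ∞) {T τ : ℝ} (hτ : 0 < τ)
    [DecidablePred fun s => τ ≤ volume.real (E s ∩ K)]
    (h : ∀ᵐ c : ℂ, c ∈ K → ((Finset.univ.filter fun s => c ∈ E s).card : ℝ) ≤ T) :
    ((Finset.univ.filter fun s => τ ≤ volume.real (E s ∩ K)).card : ℝ) ≤
      T * volume.real K / τ := by
  have hint : ∀ s, Integrable ((E s ∩ K).indicator fun _ : ℂ => (1 : ℝ)) := by
    intro s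
    rw [integrable_indicator_iff ((hE s).inter hK)]
    exact integrableOn_const (ne_top_of_le_ne_top hKfin (measure_mono Set.inter_subset_right))
  have h1 : ∑ s, volume.real (E s ∩ K) ≤ T * volume.real K := by
    have e : ∀ s, volume.real (E s ∩ K) = ∫ c, (E s ∩ K).indicator (fun _ : ℂ => (1 : ℝ)) c := by
      intro s
      rw [integral_indicator ((hE s).inter hK), setIntegral_const, smul_eq_mul, mul_one]
    simp_rw [e]
    rw [← integral_finsetSum _ fun s _ => hint s]
    have e2 : T * volume.real K = ∫ c, K.indicator (fun _ : ℂ => T) c := by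
      rw [integral_indicator hK, setIntegral_const, smul_eq_mul, mul_comm]
    rw [e2]
    refine integral_mono_ae (integrable_finsetSum _ fun s _ => hint s)
      ((integrable_indicator_iff hK).2 (integrableOn_const hKfin)) ?_
    filter_upwards [h] with c hc
    by_cases hcK : c ∈ K
    · rw [Set.indicator_of_mem hcK]
      refine le_trans (le_of_eq ?_) (hc hcK)
      rw [Finset.card_filter]
      push_cast
      refine Finset.sum_congr rfl fun s _ => ?_
      by_cases hcE : c ∈ E s <;> simp [hcE, hcK]
    · rw [Set.indicator_of_notMem hcK]
      refine le_of_eq (Finset.sum_eq_zero fun s _ => ?_)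
      rw [Set.indicator_of_notMem fun hc => hcK hc.2]
  rw [le_div_iff₀ hτ]
  refine le_trans ?_ h1
  rw [← nsmul_eq_mul, ← Finset.sum_const, Finset.sum_filter]
  refine Finset.sum_le_sum fun s _ => ?_
  split_ifs with hs
  · exact hs
  · exact measureReal_nonneg

end Rows
-- Comparison of the zeros of the derivative with the random row
section Arrays

open Polynomial

/-- The row obtained by selecting one of the two entries of the arrays at every place. -/
def selectRow (a b : TriangularArray) (n : ℕ) (s : Fin n → Bool) (i : Fin n) : ℂ :=
  cond (s i) (a n i) (b n i)

/-- Finiteness of the extended sum rules out coinciding pairs in all late rows, after which the sum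
is an ordinary real one. -/
theorem eventually_sum_posLog_le {a b : TriangularArray}
    (hab : Tendsto (fun n : ℕ => (∑ i : Fin n, logPlusInvDist (a n i) (b n i)) / (n : ℝ≥0∞) ^ 2)
      atTop (𝓝 0)) {η : ℝ} (hη : 0 < η) :
    ∀ᶠ n : ℕ in atTop, (∀ i, a n i ≠ b n i) ∧
      ∑ i, Real.posLog (1 / ‖a n i - b n i‖) ≤ η * n ^ 2 := by
  have h := (ENNReal.tendsto_nhds_zero.1 hab) (ENNReal.ofReal η) (by simpa using hη)
  filter_upwards [h, eventually_gt_atTop 0] with n hn hn0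
  have hn0' : (0 : ℝ) < n := by exact_mod_cast hn0
  rw [ENNReal.div_le_iff (by positivity) (by finiteness)] at hn
  have hne : ∀ i, a n i ≠ b n i := by
    intro i hi
    have h1 : logPlusInvDist (a n i) (b n i) = ⊤ := by simp [logPlusInvDist, hi]
    have h2 := Finset.single_le_sum (f := fun i => logPlusInvDist (a n i) (b n i))
      (fun _ _ => zero_le) (Finset.mem_univ i)
    rw [h1, top_le_iff] at h2
    rw [h2, top_le_iff] at hn
    exact absurd hn (by finiteness)
  refine ⟨hne, ?_⟩
  have e : ∑ i, logPlusInvDist (a n i) (b n i) =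
      ENNReal.ofReal (∑ i, Real.posLog (1 / ‖a n i - b n i‖)) := by
    rw [ENNReal.ofReal_sum_of_nonneg fun i _ => Real.posLog_nonneg]
    exact Finset.sum_congr rfl fun i _ => by simp [logPlusInvDist, hne i]
  rw [e, show (n : ℝ≥0∞) ^ 2 = ENNReal.ofReal ((n : ℝ) ^ 2) by
      rw [ENNReal.ofReal_pow hn0'.le, ENNReal.ofReal_natCast],
    ← ENNReal.ofReal_mul hη.le, ENNReal.ofReal_le_ofReal_iff (by positivity)] at hn
  exact hn

theorem mul_card_filter_le_sum {ι : Type*} (J : Finset ι) (g : ι → ℝ) (hg : ∀ i, 0 ≤ g i)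
    (p : ι → Prop) [DecidablePred p] {t : ℝ} (h : ∀ i, p i → t ≤ g i) :
    t * (J.filter p).card ≤ ∑ i ∈ J, g i := by
  calc t * (J.filter p).card = ∑ _i ∈ J.filter p, t := by
        rw [Finset.sum_const, nsmul_eq_mul, mul_comm]
    _ ≤ ∑ i ∈ J.filter p, g i := Finset.sum_le_sum fun i hi => h i (Finset.mem_filter.1 hi).2
    _ ≤ ∑ i ∈ J, g i := Finset.sum_le_sum_of_subset_of_nonneg (Finset.filter_subset _ _)
        fun i _ _ => hg i

theorem TriangularArray.IsLogCesaroBounded.exists_sum_le {a : TriangularArray}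
    (ha : a.IsLogCesaroBounded) : ∃ C : ℝ, 0 < C ∧ ∀ n, ∑ i, Real.posLog ‖a n i‖ ≤ C * n := by
  obtain ⟨C, hC⟩ := ha
  refine ⟨max C 1, by positivity, fun n => ?_⟩
  rcases Nat.eq_zero_or_pos n with rfl | hn
  · simp
  · have h := hC n hn
    have hn' : (0 : ℝ) < n := by exact_mod_cast hn
    rw [one_div, inv_mul_le_iff₀ hn'] at h
    calc _ ≤ n * C := h
      _ = C * n := mul_comm _ _
      _ ≤ max C 1 * n := by gcongr; exact le_max_left _ _

open Classical in
/-- A positive proportion of the pairs are bounded and not too close. -/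
theorem exists_eventually_card_good_ge {a b : TriangularArray}
    (ha_log : a.IsLogCesaroBounded) (hb_log : b.IsLogCesaroBounded)
    (hab : Tendsto (fun n : ℕ => (∑ i : Fin n, logPlusInvDist (a n i) (b n i)) / (n : ℝ≥0∞) ^ 2)
      atTop (𝓝 0)) :
    ∃ R : ℝ, 1 ≤ R ∧ ∀ δ : ℝ, 0 < δ → ∀ M : ℕ, ∀ᶠ n : ℕ in atTop,
      M ≤ (Finset.univ.filter fun i : Fin n => Real.exp (-(δ * n)) ≤ ‖a n i - b n i‖ ∧
        ‖a n i‖ ≤ R ∧ ‖b n i‖ ≤ R).card := by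
  obtain ⟨C₁, hC₁, h₁⟩ := ha_log.exists_sum_le
  obtain ⟨C₂, hC₂, h₂⟩ := hb_log.exists_sum_le
  -- By Markov at most n/4 indices are lost to entries larger than e^L, and at most n/4 to pairs
  -- closer than e^{-δn}. At least n/2 ≥ 2M remain. The radius e^L does not depend on δ.
  set L := 4 * (C₁ + C₂) with hL
  have hlarge : ∀ w : ℂ, ¬ ‖w‖ ≤ Real.exp L → L ≤ Real.posLog ‖w‖ := by
    intro w hw
    rw [not_le] at hw
    have hlog := Real.log_le_log (Real.exp_pos L) hw.le
    rw [Real.log_exp] at hlog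
    rw [Real.posLog_def]
    exact hlog.trans (le_max_right _ _)
  refine ⟨Real.exp L, Real.one_le_exp (by positivity), fun δ hδ M => ?_⟩
  filter_upwards [eventually_sum_posLog_le hab (show 0 < δ / 4 by positivity),
    eventually_ge_atTop (4 * M), eventually_gt_atTop 0] with n hn hnM hn0
  have hn0' : (0 : ℝ) < n := by exact_mod_cast hn0
  have e₁ := mul_card_filter_le_sum Finset.univ (fun i => Real.posLog ‖a n i‖)
    (fun i => Real.posLog_nonneg) (fun i => ¬ ‖a n i‖ ≤ Real.exp L) fun i hi => hlarge _ hi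
  have e₂ := mul_card_filter_le_sum Finset.univ (fun i => Real.posLog ‖b n i‖)
    (fun i => Real.posLog_nonneg) (fun i => ¬ ‖b n i‖ ≤ Real.exp L) fun i hi => hlarge _ hi
  have e₃ := mul_card_filter_le_sum Finset.univ (fun i => Real.posLog (1 / ‖a n i - b n i‖))
    (fun i => Real.posLog_nonneg) (fun i => ¬ Real.exp (-(δ * n)) ≤ ‖a n i - b n i‖)
    (t := δ * n) fun i hi => by
      rw [not_le] at hi
      have hpos : 0 < ‖a n i - b n i‖ := norm_pos_iff.2 (sub_ne_zero.2 (hn.1 i))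
      have hlog := Real.log_le_log hpos hi.le
      rw [Real.log_exp] at hlog
      have hinv : δ * n ≤ Real.log (1 / ‖a n i - b n i‖) := by
        rw [one_div, Real.log_inv]
        linarith
      rw [Real.posLog_def]
      exact hinv.trans (le_max_right _ _)
  set G := Finset.univ.filter fun i : Fin n => Real.exp (-(δ * n)) ≤ ‖a n i - b n i‖ ∧
        ‖a n i‖ ≤ Real.exp L ∧ ‖b n i‖ ≤ Real.exp L
  set X₁ := Finset.univ.filter fun i : Fin n => ¬ ‖a n i‖ ≤ Real.exp L
  set X₂ := Finset.univ.filter fun i : Fin n => ¬ ‖b n i‖ ≤ Real.exp L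
  set X₃ := Finset.univ.filter fun i : Fin n => ¬ Real.exp (-(δ * n)) ≤ ‖a n i - b n i‖
  have hcover : n ≤ G.card + (X₁.card + (X₂.card + X₃.card)) := by
    have hsub : (Finset.univ : Finset (Fin n)) ⊆ G ∪ (X₁ ∪ (X₂ ∪ X₃)) := by
      intro i _
      simp only [G, X₁, X₂, X₃, Finset.mem_union, Finset.mem_filter, Finset.mem_univ, true_and]
      tauto
    calc n = (Finset.univ : Finset (Fin n)).card := by simp
      _ ≤ _ := Finset.card_le_card hsub
      _ ≤ _ := (Finset.card_union_le _ _).trans (Nat.add_le_add_left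
          ((Finset.card_union_le _ _).trans (Nat.add_le_add_left (Finset.card_union_le _ _) _)) _)
  have hX₁₂ : (X₁.card : ℝ) + X₂.card ≤ n / 4 := by
    have h3 : L * ((X₁.card : ℝ) + X₂.card) ≤ L * (n / 4) := by
      have := h₁ n
      have := h₂ n
      rw [hL] at e₁ e₂ ⊢
      linarith
    exact le_of_mul_le_mul_left h3 (by positivity)
  have hX₃ : (X₃.card : ℝ) ≤ n / 4 := by
    have h3 : δ * n * X₃.card ≤ δ * n * (n / 4) := by
      have := hn.2
      calc _ ≤ _ := e₃
        _ ≤ _ := this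
        _ = _ := by ring
    exact le_of_mul_le_mul_left h3 (by positivity)
  have hcover' : (n : ℝ) ≤ G.card + (X₁.card + (X₂.card + X₃.card)) := by exact_mod_cast hcover
  have hM : (4 * M : ℝ) ≤ n := by exact_mod_cast hnM
  have : (M : ℝ) ≤ G.card := by linarith
  exact_mod_cast this

theorem eventually_mul_log_add_le {A B c r : ℝ} (hr : 0 < r) (hc : 0 < c) :
    ∀ᶠ n : ℕ in atTop, A * Real.log (n / r) + B ≤ c * n := by
  have h1 : Tendsto (fun n : ℕ => (A * Real.log (n / r) + B) / n) atTop (𝓝 0) := by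
    have hlog : Tendsto (fun n : ℕ => Real.log n / n) atTop (𝓝 0) := by
      have := (Real.isLittleO_log_id_atTop.tendsto_div_nhds_zero).comp
        (tendsto_natCast_atTop_atTop (R := ℝ))
      exact this
    have hinv : Tendsto (fun n : ℕ => (1 : ℝ) / n) atTop (𝓝 0) := tendsto_one_div_atTop_nhds_zero_nat
    have h2 := (hlog.const_mul A).add (hinv.const_mul (B - A * Real.log r))
    rw [mul_zero, mul_zero, add_zero] at h2
    refine h2.congr' ?_
    filter_upwards [eventually_gt_atTop 0] with n hn
    have hn' : (n : ℝ) ≠ 0 := by exact_mod_cast hn.ne'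
    rw [Real.log_div hn' hr.ne']
    field_simp
    ring
  filter_upwards [h1.eventually (gt_mem_nhds hc), eventually_gt_atTop 0] with n hn hn0
  have hn' : (0 : ℝ) < n := by exact_mod_cast hn0
  rw [div_lt_iff₀ hn'] at hn
  exact hn.le

open Classical in
/-- Up to an error `ε n` and with high probability, the zeros of the `k`-th derivative charge
compactly supported nonnegative test functions no more than the zeros of the polynomial. -/
theorem eventually_card_sum_roots_gt_le {a b : TriangularArray}
    (ha_log : a.IsLogCesaroBounded) (hb_log : b.IsLogCesaroBounded)
    (hab : Tendsto (fun n : ℕ => (∑ i : Fin n, logPlusInvDist (a n i) (b n i)) / (n : ℝ≥0∞) ^ 2)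
      atTop (𝓝 0)) (k : ℕ) {f : ℂ → ℝ} (hf : Continuous f) (hfc : HasCompactSupport f)
    (hf0 : ∀ c, 0 ≤ f c) {ε ζ : ℝ} (hε : 0 < ε) (hζ : 0 < ζ) :
    ∀ᶠ n : ℕ in atTop, ((Finset.univ.filter fun s : Fin n → Bool =>
      ∑ i, f (selectRow a b n s i) + ε * n <
        ((derivative^[k] (polyOfZeros (selectRow a b n s))).roots.map f).sum).card : ℝ) ≤
      ζ * 2 ^ n := by
  obtain ⟨B, hB0, hB⟩ : ∃ B, 0 < B ∧ ∀ c, f c ≤ B := by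
    obtain ⟨B, hB⟩ := hf.bounded_above_of_compact_support hfc
    exact ⟨max B 1, by positivity, fun c =>
      (le_abs_self _).trans ((hB c).trans (le_max_left _ _))⟩
  obtain ⟨ρ, hρ0, hρ⟩ : ∃ ρ, 0 ≤ ρ ∧ ∀ c, c ∉ Metric.closedBall (0 : ℂ) ρ → f c = 0 := by
    obtain ⟨ρ, hρ⟩ := hfc.isCompact.isBounded.subset_closedBall (0 : ℂ)
    refine ⟨max ρ 0, le_max_right _ _, fun c hc => ?_⟩
    by_contra h
    exact hc (Metric.closedBall_subset_closedBall (le_max_left _ _)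
      (hρ (subset_tsupport f (Function.mem_support.2 h))))
  obtain ⟨r, hr, hmod⟩ : ∃ r, 0 < r ∧ ∀ x y, ‖x - y‖ < r → f x ≤ f y + ε / 8 := by
    obtain ⟨r, hr, h⟩ := Metric.uniformContinuous_iff.1
      (hfc.uniformContinuous_of_continuous hf) (ε / 8) (by positivity)
    refine ⟨r, hr, fun x y hxy => ?_⟩
    have h1 := h (show dist x y < r by rwa [dist_eq_norm])
    rw [Real.dist_eq] at h1
    linarith [le_abs_self (f x - f y)]
  set I := ∫ w : ℂ, Real.posLog (r / ‖w‖) with hI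
  have hI0 : 0 < I := integral_posLog_div_norm_pos hr
  obtain ⟨m, hm⟩ : ∃ m : ℕ, (I - ∫ w : ℂ, min (Real.posLog (r / ‖w‖)) m) * B < I * ε / 8 := by
    have h1 := ((tendsto_integral_min_posLog hr).const_sub I).mul_const B
    rw [← hI, sub_self, zero_mul] at h1
    exact (h1.eventually (gt_mem_nhds (show 0 < I * ε / 8 by positivity))).exists
  set Im := ∫ w : ℂ, min (Real.posLog (r / ‖w‖)) m with hIm
  have hImI : Im ≤ I := by
    refine integral_mono_of_nonneg
      (Eventually.of_forall fun w => le_min Real.posLog_nonneg (Nat.cast_nonneg m))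
      (integrable_posLog_div_norm hr) (Eventually.of_forall fun w => min_le_left _ _)
  set F := ∫ c, f c with hF
  have hF0 : 0 ≤ F := integral_nonneg hf0
  -- Error budget: the truncation of the kernel, the two moduli of continuity, the shift Δ and the
  -- exceptional area each cost at most Iεn/8, five eighths of the available Iεn in total. The
  -- values of m, τ and δ are chosen for this.
  set τ := I * ε / (8 * B * (m + 1)) with hτ
  have hτ0 : 0 < τ := by positivity
  set δ := I * ε / (16 * (k + 1) * (F + 1)) with hδ
  have hδ0 : 0 < δ := by positivity
  set K := Metric.closedBall (0 : ℂ) ρ with hK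
  set V := volume.real K with hV
  have hV0 : 0 ≤ V := measureReal_nonneg
  obtain ⟨R, hR, hgood⟩ := exists_eventually_card_good_ge ha_log hb_log hab
  -- The factor τ/(V + 1) compensates the loss V/τ in the Markov step.
  obtain ⟨M, hM⟩ := exists_card_norm_eval_iterate_derivative_lt_le k
    (show 0 < ζ * τ / (V + 1) by positivity)
  filter_upwards [hgood δ hδ0 M, eventually_gt_atTop 0,
    eventually_mul_log_add_le (A := k) (B := k * Real.log (8 * (R + ρ) ^ 2)) hr
      (show 0 < I * ε / (16 * (F + 1)) by positivity),
    eventually_ge_atTop ⌈r⌉₊] with n hJ hn0 hlog hnr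
  have hn0' : (0 : ℝ) < n := by exact_mod_cast hn0
  set J := Finset.univ.filter fun i : Fin n => Real.exp (-(δ * n)) ≤ ‖a n i - b n i‖ ∧
        ‖a n i‖ ≤ R ∧ ‖b n i‖ ≤ R with hJdef
  set z : Fin n → Bool → ℂ := fun i β => cond β (a n i) (b n i) with hz
  set θ := (Real.exp (-(δ * n)) / (R + ρ) ^ 2 / 8) ^ k with hθ
  have hpt := hM n z J (Real.exp (-(δ * n))) R hJ (Real.exp_pos _)
    (fun i hi => (Finset.mem_filter.1 hi).2.1)
    (fun i hi β => by
      obtain ⟨-, -, h1, h2⟩ := Finset.mem_filter.1 hi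
      cases β
      · exact h2
      · exact h1)
  have hfin : ∀ᵐ c : ℂ, ∀ i β, c ≠ z i β := by
    rw [ae_all_iff]
    intro i
    rw [ae_all_iff]
    intro β
    exact Measure.ae_ne volume (z i β)
  set E : (Fin n → Bool) → Set ℂ := fun s => smallDerivSet (polyOfZeros (selectRow a b n s)) k θ
    with hE
  have hvol := card_volume_ge_le E (fun s => measurableSet_smallDerivSet _ _ _)
    (K := K) measurableSet_closedBall measure_closedBall_lt_top.ne
    (T := ζ * τ / (V + 1) * 2 ^ n) hτ0 (by
      filter_upwards [hfin] with c hc hcK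
      exact hpt c ρ (by simpa [hK] using hcK) hc)
  have hvol' : ζ * τ / (V + 1) * 2 ^ n * V / τ ≤ ζ * 2 ^ n := by
    rw [show ζ * τ / (V + 1) * 2 ^ n * V / τ = ζ * 2 ^ n * (V / (V + 1)) by field_simp]
    refine mul_le_of_le_one_right (by positivity) ?_
    rw [div_le_one (by positivity)]
    linarith
  refine le_trans (Nat.cast_le.2 (Finset.card_le_card ?_)) (hvol.trans hvol')
  intro s hs
  simp only [Finset.mem_filter, Finset.mem_univ, true_and] at hs ⊢
  by_contra! hlt
  set p := polyOfZeros (selectRow a b n s) with hp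
  -- D is -log θ; its part kδn is linear in n with a small slope, and the rest is constant.
  set D := k * (δ * n + Real.log (8 * (R + ρ) ^ 2)) with hD
  have hRρ : 1 ≤ R + ρ := by linarith
  have hθD : θ = Real.exp (-D) := by
    rw [hθ, hD, ← mul_neg (k : ℝ), Real.exp_nat_mul]
    congr 1
    rw [neg_add, Real.exp_add, Real.exp_neg (Real.log _), Real.exp_log (by positivity)]
    field_simp
  have hlog8 : 0 ≤ Real.log (8 * (R + ρ) ^ 2) := Real.log_nonneg (by nlinarith)
  have hlogn : 0 ≤ Real.log (n / r) := by
    refine Real.log_nonneg ((one_le_div hr).2 ?_)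
    exact (Nat.le_ceil r).trans (by exact_mod_cast hnr)
  set Δ := k * Real.log (n / r) + D with hΔ
  have hΔ0 : 0 ≤ Δ := by positivity
  have hΔF : Δ * F ≤ n * (I * ε / 8) := by
    have h1 : Δ ≤ I * ε / (8 * (F + 1)) * n := by
      have h2 : k * (δ * n) ≤ I * ε / (16 * (F + 1)) * n := by
        have h3 : k * δ ≤ I * ε / (16 * (F + 1)) := by
          rw [hδ, show k * (I * ε / (16 * (k + 1) * (F + 1))) =
            I * ε / (16 * (F + 1)) * (k / (k + 1)) by field_simp]
          refine mul_le_of_le_one_right (by positivity) ?_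
          rw [div_le_one (by positivity)]
          linarith
        calc _ = k * δ * n := by ring
          _ ≤ _ := by gcongr
      calc Δ = k * (δ * n) + (k * Real.log (n / r) + k * Real.log (8 * (R + ρ) ^ 2)) := by
            rw [hΔ, hD]; ring
        _ ≤ _ := add_le_add h2 hlog
        _ = _ := by field_simp; ring
    calc Δ * F ≤ I * ε / (8 * (F + 1)) * n * F := by gcongr
      _ = n * (I * ε / 8) * (F / (F + 1)) := by field_simp
      _ ≤ _ := by
        refine mul_le_of_le_one_right (by positivity) ?_
        rw [div_le_one (by positivity)]
        linarith
  have hroots : p.roots = Finset.univ.val.map (selectRow a b n s) := roots_polyOfZeros _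
  have hdeg : p.natDegree = n := natDegree_polyOfZeros _
  have hScard : (derivative^[k] p).roots.card ≤ n := by
    refine (card_roots' _).trans ?_
    rw [natDegree_iterate_derivative_eq, hdeg]
    omega
  have hmain := sum_le_of_sum_posLog_le (S := (derivative^[k] p).roots) (W := p.roots) (N := n)
    hf hf0 hB hρ hr (show 0 ≤ ε / 8 by positivity) hmod (Nat.cast_nonneg m) hScard
    (by rw [hroots]; simp) hΔ0 (measurableSet_smallDerivSet p k θ) (by
      filter_upwards [hfin] with c hc hcE
      have hpc : p.eval c ≠ 0 := by
        rw [hp, eval_polyOfZeros, Finset.prod_ne_zero_iff]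
        exact fun i _ => sub_ne_zero.2 (hc i (s i))
      have h1 : Real.exp (-D) * ‖p.eval c‖ ≤ ‖(derivative^[k] p).eval c‖ := by
        rw [← hθD]
        exact not_lt.1 hcE
      have h2 := sum_posLog_roots_iterate_derivative_le hr (by rw [hdeg]; exact hn0) hpc h1
      rw [hdeg] at h2
      rw [hΔ]
      linarith)
  rw [← hI, ← hIm, ← hF] at hmain
  have hW : (p.roots.map f).sum = ∑ i, f (selectRow a b n s i) := by
    rw [hroots, Multiset.map_map]; rfl
  rw [hW] at hmain
  set Sf := ((derivative^[k] p).roots.map f).sum with hSf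
  set Wf := ∑ i, f (selectRow a b n s i) with hWf
  have hSfB : Sf ≤ n * B := by
    have h2 := Multiset.sum_map_le_sum_map f (fun _ => B)
      fun w (_ : w ∈ (derivative^[k] p).roots) => hB w
    rw [Multiset.map_const', Multiset.sum_replicate, nsmul_eq_mul] at h2
    refine h2.trans ?_
    have h3 : ((derivative^[k] p).roots.card : ℝ) ≤ n := by exact_mod_cast hScard
    gcongr
  have hvolterm : B * n * m * volume.real (smallDerivSet p k θ ∩ K) ≤ n * (I * ε / 8) := by
    have h1 : B * n * m * volume.real (smallDerivSet p k θ ∩ K) ≤ B * n * m * τ := by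
      have := hlt.le
      gcongr
    refine h1.trans ?_
    rw [hτ, show B * n * m * (I * ε / (8 * B * (m + 1))) = n * (I * ε / 8) * (m / (m + 1)) by
      field_simp]
    refine mul_le_of_le_one_right (by positivity) ?_
    rw [div_le_one (by positivity)]
    linarith
  have h1 : (I - Im) * Sf ≤ n * (I * ε / 8) := by
    calc (I - Im) * Sf ≤ (I - Im) * (n * B) :=
          mul_le_mul_of_nonneg_left hSfB (sub_nonneg.2 hImI)
      _ = n * ((I - Im) * B) := by ring
      _ ≤ _ := by gcongr
  have h2 : Im * (n * (ε / 8)) ≤ I * (n * (ε / 8)) := by gcongr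
  have h3 : I * (Wf + ε * n) < I * Sf := mul_lt_mul_of_pos_left hs hI0
  have h4 : 0 < I * (n * ε) := by positivity
  linarith

end Arrays
-- Hoeffding's inequality, tightness and two-sided bounds
section Concentration

open Polynomial BoundedContinuousFunction

open Classical in
/-- Hoeffding's inequality on the discrete cube, upper deviations. -/
theorem card_sum_sub_ge_le {n : ℕ} {x : Fin n → Bool → ℝ} {B ε : ℝ} (hB : 0 < B)
    (hx : ∀ i b, |x i b| ≤ B) (hε : 0 < ε) :
    ((Finset.univ.filter fun s : Fin n → Bool =>
      ε * n ≤ ∑ i, x i (s i) - ∑ i, (x i true + x i false) / 2).card : ℝ) ≤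
      Real.exp (-(ε ^ 2 / (2 * B ^ 2))) ^ n * 2 ^ n := by
  -- This value minimises the Chernoff exponent -lε + l²B²/2.
  set l := ε / B ^ 2 with hl
  have hl0 : 0 < l := by positivity
  have h1 : ∀ i, ∑ β, Real.exp (l * (x i β - (x i true + x i false) / 2)) ≤
      2 * Real.exp (l ^ 2 * B ^ 2 / 2) := by
    intro i
    have h2 := Real.cosh_le_exp_half_sq (l * ((x i true - x i false) / 2))
    rw [Real.cosh_eq] at h2
    rw [Fintype.sum_bool,
      show l * (x i true - (x i true + x i false) / 2) = l * ((x i true - x i false) / 2) by ring,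
      show l * (x i false - (x i true + x i false) / 2) = -(l * ((x i true - x i false) / 2)) by
        ring]
    have h3 : Real.exp ((l * ((x i true - x i false) / 2)) ^ 2 / 2) ≤
        Real.exp (l ^ 2 * B ^ 2 / 2) := by
      rw [Real.exp_le_exp, mul_pow]
      have h4 : ((x i true - x i false) / 2) ^ 2 ≤ B ^ 2 := by
        rw [sq_le_sq, abs_of_pos hB, abs_le]
        have := abs_le.1 (hx i true)
        have := abs_le.1 (hx i false)
        constructor <;> linarith
      gcongr
    linarith
  calc ((Finset.univ.filter fun s : Fin n → Bool =>
      ε * n ≤ ∑ i, x i (s i) - ∑ i, (x i true + x i false) / 2).card : ℝ)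
      = ∑ s : Fin n → Bool, if ε * n ≤ ∑ i, x i (s i) - ∑ i, (x i true + x i false) / 2
          then (1 : ℝ) else 0 := by rw [Finset.card_filter]; push_cast; rfl
    _ ≤ ∑ s : Fin n → Bool, Real.exp (-(l * (ε * n))) *
          ∏ i, Real.exp (l * (x i (s i) - (x i true + x i false) / 2)) := by
        refine Finset.sum_le_sum fun s _ => ?_
        rw [← Real.exp_sum, ← Real.exp_add, ← Finset.mul_sum, Finset.sum_sub_distrib]
        split_ifs with h
        · refine Real.one_le_exp ?_
          have := mul_le_mul_of_nonneg_left h hl0.le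
          linarith
        · positivity
    _ = Real.exp (-(l * (ε * n))) *
          ∏ i, ∑ β, Real.exp (l * (x i β - (x i true + x i false) / 2)) := by
        rw [← Finset.mul_sum, Fintype.prod_sum]
    _ ≤ Real.exp (-(l * (ε * n))) * ∏ _i : Fin n, (2 * Real.exp (l ^ 2 * B ^ 2 / 2)) := by
        gcongr with i
        exact h1 i
    _ = _ := by
        rw [Finset.prod_const, Finset.card_univ, Fintype.card_fin, mul_pow, ← Real.exp_nat_mul,
          mul_left_comm, ← Real.exp_add, ← Real.exp_nat_mul, mul_comm]
        congr 2
        rw [hl]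
        field_simp
        ring

open Classical in
/-- Hoeffding's inequality on the discrete cube. -/
theorem card_abs_sum_sub_ge_le {n : ℕ} {x : Fin n → Bool → ℝ} {B ε : ℝ} (hB : 0 < B)
    (hx : ∀ i b, |x i b| ≤ B) (hε : 0 < ε) :
    ((Finset.univ.filter fun s : Fin n → Bool =>
      ε * n ≤ |∑ i, x i (s i) - ∑ i, (x i true + x i false) / 2|).card : ℝ) ≤
      2 * Real.exp (-(ε ^ 2 / (2 * B ^ 2))) ^ n * 2 ^ n := by
  have h1 := card_sum_sub_ge_le hB hx hε
  have h2 := card_sum_sub_ge_le (x := fun i b => -x i b) hB (fun i b => by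
    rw [abs_neg]; exact hx i b) hε
  have h3 : (Finset.univ.filter fun s : Fin n → Bool =>
      ε * n ≤ |∑ i, x i (s i) - ∑ i, (x i true + x i false) / 2|) ⊆
      (Finset.univ.filter fun s : Fin n → Bool =>
        ε * n ≤ ∑ i, x i (s i) - ∑ i, (x i true + x i false) / 2) ∪
      (Finset.univ.filter fun s : Fin n → Bool =>
        ε * n ≤ ∑ i, -x i (s i) - ∑ i, (-x i true + -x i false) / 2) := by
    intro s hs
    simp only [Finset.mem_union, Finset.mem_filter, Finset.mem_univ, true_and] at hs ⊢
    rcases le_abs.1 hs with h | h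
    · exact Or.inl h
    · right
      have e1 : ∑ i, -x i (s i) = -∑ i, x i (s i) := Finset.sum_neg_distrib _
      have e2 : ∑ i, (-x i true + -x i false) / 2 = -∑ i, (x i true + x i false) / 2 := by
        rw [← Finset.sum_neg_distrib]
        exact Finset.sum_congr rfl fun i _ => by ring
      rw [e1, e2]
      linarith
  have h4 : ((Finset.univ.filter fun s : Fin n → Bool =>
      ε * n ≤ |∑ i, x i (s i) - ∑ i, (x i true + x i false) / 2|).card : ℝ) ≤ _ :=
    Nat.cast_le.2 ((Finset.card_le_card h3).trans (Finset.card_union_le _ _))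
  push_cast at h4
  linarith

theorem integral_uniformMeasure (S : Multiset ℂ) (f : ℂ →ᵇ ℝ) :
    ∫ w, f w ∂(uniformMeasure S : Measure ℂ) = (S.card : ℝ)⁻¹ * (S.map f).sum := by
  have key : ∀ T : Multiset ℂ, ∫ w, f w ∂((T.map fun z =>
      (diracProba z).toFiniteMeasure).sum : FiniteMeasure ℂ) = (T.map f).sum := by
    intro T
    induction T using Multiset.induction_on with
    | empty => simp
    | cons z T ih =>
      rw [Multiset.map_cons, Multiset.sum_cons, FiniteMeasure.toMeasure_add,
        integral_add_measure (f.integrable _) (f.integrable _), ih, Multiset.map_cons,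
        Multiset.sum_cons]
      congr 1
      exact integral_dirac _ _
  rw [uniformMeasure, FiniteMeasure.toMeasure_smul, integral_smul_nnreal_measure, key]
  simp [NNReal.smul_def]

theorem TriangularArray.IsDistributed.tendsto_mean {a : TriangularArray}
    {μ : ProbabilityMeasure ℂ} (ha : a.IsDistributed μ) (f : ℂ →ᵇ ℝ) :
    Tendsto (fun n : ℕ => (n : ℝ)⁻¹ * ∑ i, f (a n i)) atTop (𝓝 (∫ w, f w ∂(μ : Measure ℂ))) := by
  have h := FiniteMeasure.tendsto_iff_forall_integral_tendsto.1 ha f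
  simp_rw [integral_uniformMeasure] at h
  refine h.congr fun n => ?_
  rw [Multiset.map_map, Multiset.card_map, Finset.card_val, Finset.card_univ, Fintype.card_fin]
  rfl

open Classical in
/-- The empirical measures of the random rows concentrate around `μ`. -/
theorem exists_eventually_card_abs_sum_sub_ge_le {a b : TriangularArray}
    {μ : ProbabilityMeasure ℂ} (ha : a.IsDistributed μ) (hb : b.IsDistributed μ) (f : ℂ →ᵇ ℝ)
    {ε : ℝ} (hε : 0 < ε) :
    ∃ q : ℝ, 0 < q ∧ q < 1 ∧ ∀ᶠ n : ℕ in atTop,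
      ((Finset.univ.filter fun s : Fin n → Bool =>
        ε * n ≤ |∑ i, f (selectRow a b n s i) - n * ∫ w, f w ∂(μ : Measure ℂ)|).card : ℝ) ≤
      2 * q ^ n * 2 ^ n := by
  have hB : 0 < ‖f‖ + 1 := by positivity
  refine ⟨Real.exp (-((ε / 2) ^ 2 / (2 * (‖f‖ + 1) ^ 2))), Real.exp_pos _,
    Real.exp_lt_one_iff.2 (by rw [neg_lt_zero]; positivity), ?_⟩
  -- The expected row mean is the average of the means of the two arrays, both tending to ∫ f dμ;
  -- ε/2 is spent here and ε/2 on fluctuations.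
  have hmean := ((ha.tendsto_mean f).add (hb.tendsto_mean f)).div_const 2
  rw [add_self_div_two] at hmean
  filter_upwards [Metric.tendsto_nhds.1 hmean (ε / 2) (by positivity), eventually_gt_atTop 0]
    with n hn hn0
  have hn0' : (0 : ℝ) < n := by exact_mod_cast hn0
  have h := card_abs_sum_sub_ge_le (x := fun (i : Fin n) β => f (cond β (a n i) (b n i))) hB
    (fun i β => (f.norm_coe_le_norm _).trans (by linarith)) (half_pos hε)
  refine le_trans (Nat.cast_le.2 (Finset.card_le_card ?_)) h
  intro s hs
  simp only [Finset.mem_filter, Finset.mem_univ, true_and, cond_true, cond_false] at hs ⊢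
  rw [Real.dist_eq] at hn
  set A := ∑ i, (f (a n i) + f (b n i)) / 2 with hA
  set m := ∫ w, f w ∂(μ : Measure ℂ) with hm
  have e : A - n * m =
      n * (((n : ℝ)⁻¹ * ∑ i, f (a n i) + (n : ℝ)⁻¹ * ∑ i, f (b n i)) / 2 - m) := by
    rw [hA, ← Finset.sum_div, Finset.sum_add_distrib]
    field_simp
  have h1 : |A - n * m| ≤ n * (ε / 2) := by
    rw [e, abs_mul, abs_of_pos hn0']
    gcongr
  have h2 := abs_add_le (∑ i, f (selectRow a b n s i) - A) (A - n * m)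
  rw [sub_add_sub_cancel] at h2
  change ε / 2 * n ≤ |∑ i, f (selectRow a b n s i) - A|
  linarith

/-- A continuous cutoff function equal to `1` on the disc of radius `R`. -/
noncomputable def discCutoff (R : ℝ) (w : ℂ) : ℝ := max 0 (min 1 (R + 1 - ‖w‖))

theorem continuous_discCutoff (R : ℝ) : Continuous (discCutoff R) := by
  unfold discCutoff
  fun_prop

theorem discCutoff_nonneg (R : ℝ) (w : ℂ) : 0 ≤ discCutoff R w := le_max_left _ _

theorem discCutoff_le_one (R : ℝ) (w : ℂ) : discCutoff R w ≤ 1 :=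
  max_le zero_le_one (min_le_left _ _)

theorem discCutoff_eq_one {R : ℝ} {w : ℂ} (h : ‖w‖ ≤ R) : discCutoff R w = 1 := by
  rw [discCutoff, min_eq_left (by linarith), max_eq_right zero_le_one]

theorem hasCompactSupport_discCutoff (R : ℝ) : HasCompactSupport (discCutoff R) := by
  refine HasCompactSupport.intro (isCompact_closedBall (0 : ℂ) (R + 1)) fun w hw => ?_
  have hw' : R + 1 < ‖w‖ := by simpa using hw
  rw [discCutoff, max_eq_left]
  exact (min_le_right _ _).trans (by linarith)

open Classical in
/-- With high probability the zeros of the `k`-th derivative do not charge a bounded continuous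
nonnegative function more than `μ` does, up to `ε`. -/
theorem eventually_card_sum_roots_gt_integral_le {a b : TriangularArray}
    {μ : ProbabilityMeasure ℂ} (ha : a.IsDistributed μ) (hb : b.IsDistributed μ)
    (ha_log : a.IsLogCesaroBounded) (hb_log : b.IsLogCesaroBounded)
    (hab : Tendsto (fun n : ℕ => (∑ i : Fin n, logPlusInvDist (a n i) (b n i)) / (n : ℝ≥0∞) ^ 2)
      atTop (𝓝 0)) (k : ℕ) (g : ℂ →ᵇ ℝ) (hg : ∀ w, 0 ≤ g w) {ε ζ : ℝ} (hε : 0 < ε)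
    (hζ : 0 < ζ) :
    ∀ᶠ n : ℕ in atTop, ((Finset.univ.filter fun s : Fin n → Bool =>
      (n - k) * (∫ w, g w ∂(μ : Measure ℂ) + ε) <
        ((derivative^[k] (polyOfZeros (selectRow a b n s))).roots.map g).sum).card : ℝ) ≤
      ζ * 2 ^ n := by
  obtain ⟨C₁, hC₁, h₁⟩ := ha_log.exists_sum_le
  obtain ⟨C₂, hC₂, h₂⟩ := hb_log.exists_sum_le
  set B := ‖g‖ + 1 with hB
  have hB0 : 0 < B := by positivity
  have hgB : ∀ w, g w ≤ B := fun w => by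
    have := (le_abs_self _).trans (g.norm_coe_le_norm w)
    rw [hB]
    linarith
  set C := C₁ + C₂ + 1 with hC
  -- Zeros beyond e^L have log₊ at least L, so they contribute at most (B/L) C n = εn/4. The summand
  -- 1 in C absorbs the k log n of Mahler's inequality.
  set L := 4 * B * C / ε with hL
  have hL0 : 0 < L := by positivity
  set χ := discCutoff (Real.exp L) with hχ
  have hcut : ∀ w : ℂ, g w ≤ g w * χ w + B / L * Real.posLog ‖w‖ := by
    intro w
    have hpos : 0 ≤ B / L * Real.posLog ‖w‖ := mul_nonneg (by positivity) Real.posLog_nonneg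
    by_cases hw : ‖w‖ ≤ Real.exp L
    · rw [hχ, discCutoff_eq_one hw, mul_one]
      linarith
    · rw [not_le] at hw
      have hlog := Real.log_le_log (Real.exp_pos L) hw.le
      rw [Real.log_exp] at hlog
      have hlog' : L ≤ Real.posLog ‖w‖ := by
        rw [Real.posLog_def]
        exact hlog.trans (le_max_right _ _)
      have h3 : B ≤ B / L * Real.posLog ‖w‖ := by
        calc B = B / L * L := by field_simp
          _ ≤ _ := by gcongr
      have := hgB w
      have := mul_nonneg (hg w) (discCutoff_nonneg (Real.exp L) w)
      linarith
  obtain ⟨q, hq0, hq1, hconc⟩ := exists_eventually_card_abs_sum_sub_ge_le ha hb g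
    (show 0 < ε / 4 by positivity)
  have hqt : ∀ᶠ n : ℕ in atTop, 2 * q ^ n ≤ ζ / 2 := by
    have h3 := (tendsto_pow_atTop_nhds_zero_of_lt_one hq0.le hq1).const_mul 2
    rw [mul_zero] at h3
    filter_upwards [h3.eventually (gt_mem_nhds (half_pos hζ))] with n hn
    exact hn.le
  set I := ∫ w, g w ∂(μ : Measure ℂ) with hI
  -- The fourth error ε/4: replacing n by n - k costs k(I + ε) ≤ εn/4.
  obtain ⟨N, hN⟩ := exists_nat_ge (4 * (k * (I + ε)) / ε)
  filter_upwards [hconc, hqt,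
    eventually_card_sum_roots_gt_le ha_log hb_log hab k
      (f := fun w => g w * χ w) (g.continuous.mul (continuous_discCutoff _))
      ((hasCompactSupport_discCutoff (Real.exp L)).mul_left)
      (fun c => mul_nonneg (hg c) (discCutoff_nonneg _ c))
      (show 0 < ε / 4 by positivity) (half_pos hζ),
    eventually_mul_log_add_le (A := k) (B := 0) one_pos one_pos,
    eventually_ge_atTop N, eventually_gt_atTop k] with n hn₁ hn₂ hn₃ hlog hnN hnk
  have hnN' : (N : ℝ) ≤ n := by exact_mod_cast hnN
  rw [add_zero, div_one, one_mul] at hlog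
  have hsub : (Finset.univ.filter fun s : Fin n → Bool => (n - k) * (I + ε) <
        ((derivative^[k] (polyOfZeros (selectRow a b n s))).roots.map g).sum) ⊆
      (Finset.univ.filter fun s : Fin n → Bool =>
        ε / 4 * n ≤ |∑ i, g (selectRow a b n s i) - n * I|) ∪
      (Finset.univ.filter fun s : Fin n → Bool =>
        ∑ i, g (selectRow a b n s i) * χ (selectRow a b n s i) + ε / 4 * n <
        ((derivative^[k] (polyOfZeros (selectRow a b n s))).roots.map fun w =>
          g w * χ w).sum) := by
    intro s hs
    simp only [Finset.mem_union, Finset.mem_filter, Finset.mem_univ, true_and] at hs ⊢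
    by_contra! hcon
    obtain ⟨hc₁, hc₂⟩ := hcon
    set p := polyOfZeros (selectRow a b n s) with hp
    have hdeg : p.natDegree = n := natDegree_polyOfZeros _
    have hpl := sum_posLog_norm_roots_iterate_derivative_le (p := p) (k := k)
      (polyOfZeros_monic _) (by rw [hdeg]; exact hnk)
    rw [hdeg, roots_polyOfZeros, Multiset.map_map] at hpl
    have hsel : ((Finset.univ.val : Multiset (Fin n)).map
        ((fun w : ℂ => Real.posLog ‖w‖) ∘ selectRow a b n s)).sum ≤ (C₁ + C₂) * n := by
      change ∑ i, Real.posLog ‖selectRow a b n s i‖ ≤ _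
      have h3 : ∑ i, Real.posLog ‖selectRow a b n s i‖ ≤
          ∑ i, (Real.posLog ‖a n i‖ + Real.posLog ‖b n i‖) := by
        refine Finset.sum_le_sum fun i _ => ?_
        have ha0 : 0 ≤ Real.posLog ‖a n i‖ := Real.posLog_nonneg
        have hb0 : 0 ≤ Real.posLog ‖b n i‖ := Real.posLog_nonneg
        rw [selectRow]
        cases s i
        · simpa using ha0
        · simpa using hb0
      rw [Finset.sum_add_distrib] at h3
      linarith [h₁ n, h₂ n]
    have hroots : ((derivative^[k] p).roots.map fun w => Real.posLog ‖w‖).sum ≤ C * n := by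
      rw [hC]
      linarith
    have hcutsum := Multiset.sum_map_le_sum_map _ _
      fun w (_ : w ∈ (derivative^[k] p).roots) => hcut w
    rw [Multiset.sum_map_add, Multiset.sum_map_mul_left] at hcutsum
    have h4 : B / L * ((derivative^[k] p).roots.map fun w => Real.posLog ‖w‖).sum ≤
        ε / 4 * n := by
      calc _ ≤ B / L * (C * n) := by gcongr
        _ = _ := by
          have hC0 : 0 < C := by positivity
          rw [hL]
          field_simp
    have h5 : ∑ i, g (selectRow a b n s i) * χ (selectRow a b n s i) ≤
        ∑ i, g (selectRow a b n s i) :=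
      Finset.sum_le_sum fun i _ => mul_le_of_le_one_right (hg _) (discCutoff_le_one _ _)
    have h6 := (abs_lt.1 hc₁).2
    have h7 : 4 * (k * (I + ε)) ≤ n * ε := (div_le_iff₀ hε).1 (hN.trans hnN')
    linarith
  have hcard : ((Finset.univ.filter fun s : Fin n → Bool => (n - k) * (I + ε) <
        ((derivative^[k] (polyOfZeros (selectRow a b n s))).roots.map g).sum).card : ℝ) ≤ _ :=
    Nat.cast_le.2 ((Finset.card_le_card hsub).trans (Finset.card_union_le _ _))
  push_cast at hcard
  have h8 : 2 * q ^ n * 2 ^ n ≤ ζ / 2 * 2 ^ n := by gcongr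
  linarith

theorem card_roots_iterate_derivative_polyOfZeros {n : ℕ} (x : Fin n → ℂ) (k : ℕ) :
    (derivative^[k] (polyOfZeros x)).roots.card = n - k := by
  rw [← (IsAlgClosed.splits _).natDegree_eq_card_roots, natDegree_iterate_derivative_eq,
    natDegree_polyOfZeros]

-- The nonnegative functions ‖f‖ + f and ‖f‖ - f turn upper bounds into two-sided ones, because
-- P_n^(k) has exactly n - k zeros and μ has mass 1. Passing to ε/2 reconciles the strict and weak
-- inequalities.
open Classical in
theorem eventually_card_abs_integral_sub_ge_le {a b : TriangularArray}
    {μ : ProbabilityMeasure ℂ} (ha : a.IsDistributed μ) (hb : b.IsDistributed μ)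
    (ha_log : a.IsLogCesaroBounded) (hb_log : b.IsLogCesaroBounded)
    (hab : Tendsto (fun n : ℕ => (∑ i : Fin n, logPlusInvDist (a n i) (b n i)) / (n : ℝ≥0∞) ^ 2)
      atTop (𝓝 0)) (k : ℕ) (f : ℂ →ᵇ ℝ) {ε ζ : ℝ} (hε : 0 < ε) (hζ : 0 < ζ) :
    ∀ᶠ n : ℕ in atTop, ((Finset.univ.filter fun s : Fin n → Bool =>
      ε ≤ |∫ w, f w ∂(zeroMeasure (derivative^[k] (polyOfZeros (selectRow a b n s))) : Measure ℂ) -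
        ∫ w, f w ∂(μ : Measure ℂ)|).card : ℝ) ≤ ζ * 2 ^ n := by
  have hbd : ∀ w, |f w| ≤ ‖f‖ := fun w => f.norm_coe_le_norm w
  have h₁ := eventually_card_sum_roots_gt_integral_le ha hb ha_log hb_log hab k
    (BoundedContinuousFunction.const ℂ ‖f‖ + f)
    (fun w => by
      have := (abs_le.1 (hbd w)).1
      simp only [BoundedContinuousFunction.coe_add, Pi.add_apply,
        BoundedContinuousFunction.const_apply]
      linarith) (half_pos hε) (half_pos hζ)
  have h₂ := eventually_card_sum_roots_gt_integral_le ha hb ha_log hb_log hab k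
    (BoundedContinuousFunction.const ℂ ‖f‖ - f)
    (fun w => by
      have := (abs_le.1 (hbd w)).2
      simp only [BoundedContinuousFunction.coe_sub, Pi.sub_apply,
        BoundedContinuousFunction.const_apply]
      linarith) (half_pos hε) (half_pos hζ)
  have e₁ : ∫ w, (BoundedContinuousFunction.const ℂ ‖f‖ + f) w ∂(μ : Measure ℂ) =
      ‖f‖ + ∫ w, f w ∂(μ : Measure ℂ) := by
    simp only [BoundedContinuousFunction.coe_add, Pi.add_apply,
      BoundedContinuousFunction.const_apply]
    rw [integral_add (integrable_const _) (f.integrable _)]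
    simp
  have e₂ : ∫ w, (BoundedContinuousFunction.const ℂ ‖f‖ - f) w ∂(μ : Measure ℂ) =
      ‖f‖ - ∫ w, f w ∂(μ : Measure ℂ) := by
    simp only [BoundedContinuousFunction.coe_sub, Pi.sub_apply,
      BoundedContinuousFunction.const_apply]
    rw [integral_sub (integrable_const _) (f.integrable _)]
    simp
  rw [e₁] at h₁
  rw [e₂] at h₂
  filter_upwards [h₁, h₂, eventually_gt_atTop k] with n hn₁ hn₂ hnk
  set m := ∫ w, f w ∂(μ : Measure ℂ) with hm
  have hnk' : (0 : ℝ) < n - k := by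
    have : (k : ℝ) < n := by exact_mod_cast hnk
    linarith
  refine le_trans (Nat.cast_le.2 (le_trans (Finset.card_le_card ?_) (Finset.card_union_le _ _)))
    (le_of_eq_of_le (Nat.cast_add _ _) ((add_le_add hn₁ hn₂).trans (le_of_eq (by ring))))
  intro s hs
  simp only [Finset.mem_union, Finset.mem_filter, Finset.mem_univ, true_and] at hs ⊢
  set S := (derivative^[k] (polyOfZeros (selectRow a b n s))).roots with hS
  have hcard : (S.card : ℝ) = n - k := by
    rw [hS, card_roots_iterate_derivative_polyOfZeros, Nat.cast_sub hnk.le]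
  rw [zeroMeasure, integral_uniformMeasure, ← hS, hcard] at hs
  have s₁ : (S.map (BoundedContinuousFunction.const ℂ ‖f‖ + f)).sum =
      (n - k) * ‖f‖ + (S.map f).sum := by
    rw [← hcard, ← nsmul_eq_mul, ← Multiset.sum_replicate, ← Multiset.map_const',
      ← Multiset.sum_map_add]
    rfl
  have s₂ : (S.map (BoundedContinuousFunction.const ℂ ‖f‖ - f)).sum =
      (n - k) * ‖f‖ - (S.map f).sum := by
    rw [← hcard, ← nsmul_eq_mul, ← Multiset.sum_replicate, ← Multiset.map_const',
      ← Multiset.sum_map_sub]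
    rfl
  rw [s₁, s₂]
  set T := (S.map f).sum with hT
  have hinv : ((n : ℝ) - k) * (((n : ℝ) - k)⁻¹ * T) = T := mul_inv_cancel_left₀ hnk'.ne' T
  have hprod : 0 < ((n : ℝ) - k) * ε := by positivity
  rcases le_abs.1 hs with h | h
  · left
    have := mul_le_mul_of_nonneg_left h hnk'.le
    rw [mul_sub, hinv] at this
    linarith
  · right
    have := mul_le_mul_of_nonneg_left h hnk'.le
    rw [neg_sub, mul_sub, hinv] at this
    linarith

end Concentration

/-! ### From counting to probability and to weak convergence -/

section Transfer

variable {Ω : Type*} [MeasurableSpace Ω]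

open Classical in
/-- Probabilities of events depending on a row of independent fair two-valued random variables are
bounded by counting. -/
theorem measure_le_card_div_of_iIndepFun {P : Measure Ω} {n : ℕ} {a b : TriangularArray}
    {ξ : Fin n → Ω → ℂ} (hξ_meas : ∀ i, Measurable (ξ i)) (hξ_indep : iIndepFun ξ P)
    (hξ_law : ∀ i, P.map (ξ i) =
      (1 / 2 : ℝ≥0∞) • Measure.dirac (a n i) + (1 / 2 : ℝ≥0∞) • Measure.dirac (b n i))
    (hne : ∀ i, a n i ≠ b n i) (Q : (Fin n → ℂ) → Prop) {T : ℝ}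
    (hT : ((Finset.univ.filter fun s => Q (selectRow a b n s)).card : ℝ) ≤ T * 2 ^ n) :
    P {ω | Q fun i => ξ i ω} ≤ ENNReal.ofReal T := by
  have hval : ∀ i w, (w = a n i ∨ w = b n i) → P (ξ i ⁻¹' {w}) = 1 / 2 := by
    intro i w hw
    rw [← Measure.map_apply (hξ_meas i) (measurableSet_singleton w), hξ_law i]
    rcases hw with rfl | rfl
    · simp [(hne i).symm]
    · simp [hne i]
  have hout : ∀ i, P (ξ i ⁻¹' {a n i, b n i}ᶜ) = 0 := by
    intro i
    rw [← Measure.map_apply (hξ_meas i) (by measurability), hξ_law i]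
    simp
  have hrow : ∀ s : Fin n → Bool,
      P (⋂ i ∈ Finset.univ, ξ i ⁻¹' {selectRow a b n s i}) = (1 / 2) ^ n := by
    intro s
    rw [hξ_indep.measure_inter_preimage_eq_mul Finset.univ
      fun i _ => measurableSet_singleton _]
    rw [Finset.prod_congr rfl fun i _ => hval i (selectRow a b n s i) ?_, Finset.prod_const,
      Finset.card_univ, Fintype.card_fin]
    rw [selectRow]
    cases s i <;> simp
  -- The event is covered by the atoms of the row law and a null set, so only subadditivity is used
  -- and Q need not be measurable.
  have hsub : {ω | Q fun i => ξ i ω} ⊆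
      (⋃ s ∈ Finset.univ.filter fun s => Q (selectRow a b n s),
        ⋂ i ∈ Finset.univ, ξ i ⁻¹' {selectRow a b n s i}) ∪
      ⋃ i, ξ i ⁻¹' {a n i, b n i}ᶜ := by
    intro ω hω
    by_cases hin : ∀ i, ξ i ω = a n i ∨ ξ i ω = b n i
    · left
      set s : Fin n → Bool := fun i => decide (ξ i ω = a n i) with hs
      have hsel : selectRow a b n s = fun i => ξ i ω := by
        funext i
        rw [selectRow, hs]
        by_cases hi : ξ i ω = a n i
        · simp [hi]
        · simp [(hin i).resolve_left hi, (hne i).symm]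
      simp only [Set.mem_iUnion]
      refine ⟨s, ?_, ?_⟩
      · simp only [Finset.mem_filter, Finset.mem_univ, true_and]
        rw [hsel]
        exact hω
      · simp [hsel]
    · right
      push Not at hin
      obtain ⟨i, hi⟩ := hin
      simp only [Set.mem_iUnion]
      exact ⟨i, by simp [hi.1, hi.2]⟩
  refine (measure_mono hsub).trans ((measure_union_le _ _).trans ?_)
  rw [measure_iUnion_null hout, add_zero]
  refine (measure_biUnion_finset_le _ _).trans ?_
  rw [Finset.sum_congr rfl fun s _ => hrow s, Finset.sum_const, nsmul_eq_mul]
  have e : ((1 : ℝ≥0∞) / 2) ^ n = ENNReal.ofReal ((1 / 2 : ℝ) ^ n) := by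
    rw [ENNReal.ofReal_pow (by positivity), ENNReal.ofReal_div_of_pos two_pos]
    simp
  rw [e, ← ENNReal.ofReal_natCast, ← ENNReal.ofReal_mul (Nat.cast_nonneg _)]
  refine ENNReal.ofReal_le_ofReal ?_
  calc _ ≤ T * 2 ^ n * (1 / 2) ^ n := by gcongr
    _ = T := by rw [mul_assoc, ← mul_pow]; norm_num

/-- Convergence in probability of random finite measures can be tested on integrals. -/
theorem tendstoInProbability_of_forall_integral {P : Measure Ω} {X : ℕ → Ω → FiniteMeasure ℂ}
    {μ : FiniteMeasure ℂ}
    (h : ∀ f : BoundedContinuousFunction ℂ ℝ, ∀ ε : ℝ, 0 < ε → Tendsto (fun n => P {ω |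
      ε ≤ |∫ w, f w ∂(X n ω : Measure ℂ) - ∫ w, f w ∂(μ : Measure ℂ)|}) atTop (𝓝 0)) :
    TendstoInProbability P X μ := by
  -- The sets missed with probability tending to 0 form a filter. Convergence in probability is
  -- convergence of the identity along it, and the integral criterion for weak convergence holds
  -- along any filter.
  let F : Filter (FiniteMeasure ℂ) :=
    Filter.comk (fun V => Tendsto (fun n => P {ω | X n ω ∈ V}) atTop (𝓝 0))
      (by simp)
      (fun t ht s hst => tendsto_of_tendsto_of_tendsto_of_le_of_le tendsto_const_nhds ht
        (fun _ => zero_le) fun n => measure_mono fun ω hω => hst hω)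
      (fun s hs t ht => by
        have h1 := hs.add ht
        rw [add_zero] at h1
        refine tendsto_of_tendsto_of_tendsto_of_le_of_le tendsto_const_nhds h1
          (fun _ => zero_le) fun n => ?_
        exact measure_union_le _ _)
  have hF : Tendsto id F (𝓝 μ) := by
    rw [FiniteMeasure.tendsto_iff_forall_integral_tendsto]
    intro f
    rw [Metric.tendsto_nhds]
    intro ε hε
    change Tendsto (fun n => P {ω | X n ω ∈ {ν : FiniteMeasure ℂ |
      dist (∫ w, f w ∂(ν : Measure ℂ)) (∫ w, f w ∂(μ : Measure ℂ)) < ε}ᶜ}) atTop (𝓝 0)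
    refine (h f ε hε).congr fun n => ?_
    congr 1
    ext ω
    simp [Real.dist_eq]
  intro U hU
  exact hF hU

/-- Almost sure weak convergence of random probability measures can be tested on one bounded
continuous function at a time. -/
theorem ae_tendsto_of_forall_integral {P : Measure Ω} {X : ℕ → Ω → FiniteMeasure ℂ}
    {μ : ProbabilityMeasure ℂ}
    (hX : ∀ᶠ n in atTop, ∀ ω, ∃ ν : ProbabilityMeasure ℂ, ν.toFiniteMeasure = X n ω)
    (h : ∀ f : BoundedContinuousFunction ℂ ℝ, ∀ ε : ℝ, 0 < ε → ∀ᵐ ω ∂P, ∀ᶠ n in atTop,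
      |∫ w, f w ∂(X n ω : Measure ℂ) - ∫ w, f w ∂(μ : Measure ℂ)| < ε) :
    ∀ᵐ ω ∂P, Tendsto (fun n => X n ω) atTop (𝓝 μ.toFiniteMeasure) := by
  -- The curried filter encodes "for almost every ω, eventually in n", so a single neighbourhood,
  -- being governed by finitely many integrals, is handled almost surely.
  have hF : Tendsto (fun p : Ω × ℕ => X p.2 p.1) ((ae P).curry atTop)
      (𝓝 μ.toFiniteMeasure) := by
    rw [FiniteMeasure.tendsto_iff_forall_integral_tendsto]
    intro f
    rw [Metric.tendsto_nhds]
    intro ε hε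
    rw [Filter.eventually_curry_iff]
    filter_upwards [h f ε hε] with ω hω
    filter_upwards [hω] with n hn
    rw [Real.dist_eq]
    exact hn
  -- First countability of the weak topology on probability measures reduces all neighbourhoods to
  -- countably many, so the null sets can be united.
  obtain ⟨U, hU⟩ := (𝓝 μ).exists_antitone_basis
  have hind := (ProbabilityMeasure.toFiniteMeasure_isEmbedding ℂ).isInducing.nhds_eq_comap μ
  have hV : ∀ m, ∃ V ∈ 𝓝 μ.toFiniteMeasure,
      ProbabilityMeasure.toFiniteMeasure ⁻¹' V ⊆ U m := by
    intro m
    have := hU.1.mem_of_mem (i := m) trivial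
    rw [hind] at this
    exact Filter.mem_comap.1 this
  choose V hVm hVU using hV
  have hall : ∀ᵐ ω ∂P, ∀ m, ∀ᶠ n in atTop, X n ω ∈ V m := by
    rw [ae_all_iff]
    intro m
    exact Filter.eventually_curry_iff.1 (hF.eventually (hVm m))
  filter_upwards [hall] with ω hω
  rw [tendsto_def]
  intro W hW
  have hW' : ProbabilityMeasure.toFiniteMeasure ⁻¹' W ∈ 𝓝 μ := by
    rw [hind]
    exact Filter.preimage_mem_comap hW
  obtain ⟨m, -, hm⟩ := hU.1.mem_iff.1 hW'
  filter_upwards [hω m, hX] with n hn hXn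
  obtain ⟨ν, hν⟩ := hXn ω
  have h1 : ν ∈ U m := hVU m (by rw [Set.mem_preimage, hν]; exact hn)
  have h2 := hm h1
  rw [Set.mem_preimage, hν] at h2
  exact h2

theorem exists_probabilityMeasure_eq_uniformMeasure {S : Multiset ℂ} (hS : S ≠ 0) :
    ∃ ν : ProbabilityMeasure ℂ, ν.toFiniteMeasure = uniformMeasure S := by
  have h : IsProbabilityMeasure (uniformMeasure S : Measure ℂ) :=
    ⟨by rw [← FiniteMeasure.ennreal_mass, uniformMeasure_mass S hS, ENNReal.coe_one]⟩
  exact ⟨⟨(uniformMeasure S : Measure ℂ), h⟩, rfl⟩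

end Transfer
-- The theorem
theorem theorem1p3 {Ω : Type*} [MeasurableSpace Ω] (P : Measure Ω) [IsProbabilityMeasure P]
    (μ : ProbabilityMeasure ℂ) (a b : TriangularArray)
    (ha : a.IsDistributed μ) (hb : b.IsDistributed μ)
    (ha_log : a.IsLogCesaroBounded) (hb_log : b.IsLogCesaroBounded)
    (hab : Tendsto (fun n : ℕ => (∑ i : Fin n, logPlusInvDist (a n i) (b n i)) / (n : ℝ≥0∞) ^ 2)
      atTop (𝓝 0))
    (ξ : (n : ℕ) → Fin n → Ω → ℂ)
    (hξ_meas : ∀ n i, Measurable (ξ n i))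
    (hξ_indep : ∀ n, iIndepFun (ξ n) P)
    (hξ_law : ∀ n i, P.map (ξ n i) =
      (1 / 2 : ℝ≥0∞) • Measure.dirac (a n i) + (1 / 2 : ℝ≥0∞) • Measure.dirac (b n i)) :
    (∀ᵐ ω ∂P, Tendsto (fun n : ℕ => zeroMeasure (polyOfZeros fun i => ξ n i ω)) atTop
      (𝓝 μ.toFiniteMeasure)) ∧
    ∀ k : ℕ, TendstoInProbability P
      (fun n ω => zeroMeasure (Polynomial.derivative^[k] (polyOfZeros fun i => ξ n i ω)))
      μ.toFiniteMeasure := by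
  classical
  have hne : ∀ᶠ n : ℕ in atTop, ∀ i, a n i ≠ b n i :=
    (eventually_sum_posLog_le hab one_pos).mono fun n hn => hn.1
  refine ⟨ae_tendsto_of_forall_integral ?_ fun f ε hε => ?_, fun k =>
    tendstoInProbability_of_forall_integral fun f ε hε => ?_⟩
  · filter_upwards [eventually_gt_atTop 0] with n hn ω
    refine exists_probabilityMeasure_eq_uniformMeasure ?_
    rw [roots_polyOfZeros, ← Multiset.card_pos]
    simpa using hn
  · obtain ⟨q, hq0, hq1, hq⟩ := exists_eventually_card_abs_sum_sub_ge_le ha hb f hε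
    -- The shift by N makes the bound valid for every index. The bounds are geometric, so the first
    -- Borel–Cantelli lemma applies without any relation between rows.
    obtain ⟨N, hN⟩ := eventually_atTop.1 ((hq.and hne).and (eventually_gt_atTop 0))
    have hbound : ∀ n, P {ω | ε * (n + N : ℕ) ≤ |∑ i, f (ξ (n + N) i ω) -
        (n + N : ℕ) * ∫ w, f w ∂(μ : Measure ℂ)|} ≤ ENNReal.ofReal (2 * q ^ (n + N)) := by
      intro n
      obtain ⟨⟨h1, h2⟩, -⟩ := hN (n + N) (by omega)
      exact measure_le_card_div_of_iIndepFun (hξ_meas _) (hξ_indep _) (hξ_law _) h2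
        (fun x => ε * (n + N : ℕ) ≤ |∑ i, f (x i) -
          (n + N : ℕ) * ∫ w, f w ∂(μ : Measure ℂ)|) h1
    have hsum : Summable fun n : ℕ => 2 * q ^ (n + N) := by
      simp_rw [pow_add]
      exact ((summable_geometric_of_lt_one hq0.le hq1).mul_right _).mul_left _
    have hae := ae_eventually_notMem (μ := P)
      (ne_top_of_le_ne_top hsum.tsum_ofReal_ne_top (ENNReal.tsum_le_tsum hbound))
    filter_upwards [hae] with ω hω
    rw [← map_add_atTop_eq_nat N, eventually_map]
    filter_upwards [hω] with n hn
    have hn0 : (0 : ℝ) < (n + N : ℕ) := by exact_mod_cast (hN (n + N) (by omega)).2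
    rw [not_le] at hn
    rw [zeroMeasure, integral_uniformMeasure, roots_polyOfZeros, Multiset.map_map,
      Multiset.card_map, Finset.card_val, Finset.card_univ, Fintype.card_fin]
    change |((n + N : ℕ) : ℝ)⁻¹ * ∑ i, f (ξ (n + N) i ω) - ∫ w, f w ∂(μ : Measure ℂ)| < ε
    refine lt_of_mul_lt_mul_right ?_ hn0.le
    rw [← abs_of_pos hn0, ← abs_mul, abs_of_pos hn0, sub_mul, mul_comm _ ((n + N : ℕ) : ℝ),
      mul_inv_cancel_left₀ hn0.ne', mul_comm _ ((n + N : ℕ) : ℝ)]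
    exact hn
  · rw [ENNReal.tendsto_nhds_zero]
    intro η hη
    obtain ⟨ζ, hζ, hζη⟩ : ∃ ζ : ℝ, 0 < ζ ∧ ENNReal.ofReal ζ ≤ η := by
      rcases eq_or_ne η ⊤ with rfl | hη'
      · exact ⟨1, one_pos, le_top⟩
      · exact ⟨η.toReal, ENNReal.toReal_pos hη.ne' hη', ENNReal.ofReal_toReal_le⟩
    filter_upwards [hne, eventually_card_abs_integral_sub_ge_le ha hb ha_log hb_log hab k f hε hζ]
      with n h1 h2
    exact (measure_le_card_div_of_iIndepFun (hξ_meas _) (hξ_indep _) (hξ_law _) h1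
      (fun x => ε ≤ |∫ w, f w ∂(zeroMeasure
        (Polynomial.derivative^[k] (polyOfZeros x)) : Measure ℂ) -
        ∫ w, f w ∂(μ : Measure ℂ)|) h2).trans hζη
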